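/- Let $n\ge 1$ and $k\ge 1$, and let $\mathbb B^n=\{x\in\mathbb R^n: |x|\le 1\}$ be the closed unit ball. Let $\Sigma$ be a compact smooth $k$-dimensional manifold with (possibly empty) boundary $\partial\Sigma$, and let $\varphi=(x_1,\dots,x_n):\Sigma\to\mathbb R^n$ be a smooth immersion with $\varphi(\Sigma)\subset\mathbb B^n$ and $\varphi(\partial\Sigma)\subset\partial\mathbb B^n$. Suppose that $\varphi$ is a free boundary minimal submanifold of $\mathbb B^n$, that is: (i) the mean curvature vector vanishes identically: $\vec H(p)=\sum_{j=1}^k A_p(e_j,e_j)=0$ for every $p\in\Sigma$, where $A_p(u,v)=(D_uv)^N$ is the second fundamental form of the immersion and $e_1,\dots,e_k$ is an orthonormal basis of $T_p\Sigma$ for the induced metric; (ii) $\Sigma$ meets $\partial\mathbb B^n$ orthogonally along $\partial\Sigma$: for every $p\in\partial\Sigma$ the outward unit conormal $\nu(p)\in T_p\Sigma$ (the unit vector tangent to $\Sigma$, orthogonal to $T_p\partial\Sigma$ and pointing out of $\Sigma$) is orthogonal to $T_{\varphi(p)}\partial\mathbb B^n$. Then the boundary of $\Sigma$ is balanced: $$\int_{\partial\Sigma}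 x_i\,ds=0\qquad\text{for each } i=1,\dots,n,$$ where $ds$ is the $(k-1)$-dimensional Riemannian measure on $\partial\Sigma$ of the metric induced by $\varphi$ (counting measure if $k=1$). -/

import Mathlib

open scoped Manifold ContDiff Topology

noncomputable section

namespace FreeBoundary

/-! Throughout, `M` is a smooth manifold with boundary of dimension `m + 1`, modelled on the closed
half-space `{x : x 0 ≥ 0}` of `ℝ^(m+1)`, and `φ : M → ℝ^n`.  In Mathlib `TangentSpace (𝓡∂ (m+1)) p`
is `ℝ^(m+1)`, a tangent vector being given by its components in the preferred chart at `p`. -/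

section Extrinsic

variable {m n : ℕ} {M : Type*} [TopologicalSpace M] [ChartedSpace (EuclideanHalfSpace (m + 1)) M]

/-- The differential `dφ_p : T_p M → ℝ^n`. -/
def differential (φ : M → EuclideanSpace ℝ (Fin n)) (p : M) :
    EuclideanSpace ℝ (Fin (m + 1)) →L[ℝ] EuclideanSpace ℝ (Fin n) :=
  mfderiv (𝓡∂ (m + 1)) 𝓘(ℝ, EuclideanSpace ℝ (Fin n)) φ p

/-- The tangent space of the immersed submanifold at `p`, as a linear subspace of `ℝ^n`. -/
def tangentPlane (φ : M → EuclideanSpace ℝ (Fin n)) (p : M) :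
    Submodule ℝ (EuclideanSpace ℝ (Fin n)) :=
  (differential (m := m) φ p).toLinearMap.range

/-- The expression of `φ` in the preferred chart at `p`, a function on (a relatively open part of)
the half-space. -/
def inChart (φ : M → EuclideanSpace ℝ (Fin n)) (p : M) :
    EuclideanSpace ℝ (Fin (m + 1)) → EuclideanSpace ℝ (Fin n) :=
  φ ∘ (extChartAt (𝓡∂ (m + 1)) p).symm

/-- The second fundamental form `A(u, v) = (D_u V)^N` at `p`.  Here `V` is the tangent vector field
along `φ` extending `v` with constant components in the preferred chart at `p`, so that `D_u V` is
the second derivative of the chart expression of `φ` (one-sided if `p` is a boundary point), and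
`(·)^N` is the orthogonal projection to the orthogonal complement of the tangent plane. -/
def secondFundamentalForm (φ : M → EuclideanSpace ℝ (Fin n)) (p : M)
    (u v : EuclideanSpace ℝ (Fin (m + 1))) : EuclideanSpace ℝ (Fin n) :=
  (tangentPlane (m := m) φ p)ᗮ.starProjection
    (fderivWithin ℝ (fderivWithin ℝ (inChart φ p) (Set.range (𝓡∂ (m + 1))))
      (Set.range (𝓡∂ (m + 1))) (extChartAt (𝓡∂ (m + 1)) p p) u v)

/-- Tangent vectors of `M` at `p` that `dφ_p` maps to an orthonormal basis of the tangent plane. -/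
def orthonormalFrame (φ : M → EuclideanSpace ℝ (Fin n)) (p : M)
    (j : Fin (Module.finrank ℝ (tangentPlane (m := m) φ p))) : EuclideanSpace ℝ (Fin (m + 1)) :=
  (LinearMap.mem_range.mp (stdOrthonormalBasis ℝ (tangentPlane (m := m) φ p) j).2).choose

/-- The mean curvature vector `H(p) = ∑ⱼ A(eⱼ, eⱼ)`, where `(eⱼ)` is orthonormal for the metric
induced by `φ`. -/
def meanCurvature (φ : M → EuclideanSpace ℝ (Fin n)) (p : M) : EuclideanSpace ℝ (Fin n) :=
  ∑ j, secondFundamentalForm φ p (orthonormalFrame (m := m) φ p j) (orthonormalFrame φ p j)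

/-- `ν` is the outward conormal at the boundary point `p`: a unit vector of the tangent plane,
orthogonal to the tangent space of the boundary (the vectors `w` with `w 0 = 0`), and the image of a
tangent vector `v` that points out of `M` (`v 0 < 0`). -/
def IsOutwardConormal (φ : M → EuclideanSpace ℝ (Fin n)) (p : M)
    (ν : EuclideanSpace ℝ (Fin n)) : Prop :=
  (∃ v : EuclideanSpace ℝ (Fin (m + 1)), v 0 < 0 ∧ differential φ p v = ν) ∧ ‖ν‖ = 1 ∧
    ∀ w : EuclideanSpace ℝ (Fin (m + 1)), w 0 = 0 → inner ℝ (differential φ p w) ν = 0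

variable (m) in
/-- `φ` is an immersed free boundary minimal submanifold of the closed unit ball of `ℝ^n`. -/
structure IsFreeBoundaryMinimal (φ : M → EuclideanSpace ℝ (Fin n)) : Prop where
  /-- `φ` is smooth. -/
  contMDiff : ContMDiff (𝓡∂ (m + 1)) 𝓘(ℝ, EuclideanSpace ℝ (Fin n)) ∞ φ
  /-- `φ` is an immersion. -/
  injective_differential : ∀ p, Function.Injective (differential (m := m) φ p)
  /-- `φ` takes its values in the closed unit ball. -/
  mem_closedBall : ∀ p, φ p ∈ Metric.closedBall (0 : EuclideanSpace ℝ (Fin n)) 1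
  /-- `φ` maps the boundary to the unit sphere. -/
  boundary_mem_sphere : ∀ p ∈ (𝓡∂ (m + 1)).boundary M,
    φ p ∈ Metric.sphere (0 : EuclideanSpace ℝ (Fin n)) 1
  /-- `φ` is minimal. -/
  meanCurvature_eq_zero : ∀ p, meanCurvature (m := m) φ p = 0
  /-- The outward conormal is orthogonal to the unit sphere, whose tangent space at `φ p` is the
  orthogonal complement of `φ p`. -/
  conormal_orthogonal : ∀ p ∈ (𝓡∂ (m + 1)).boundary M, ∀ ν, IsOutwardConormal (m := m) φ p ν →
    ∀ w, inner ℝ (φ p) w = 0 → inner ℝ ν w = 0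

end Extrinsic

section BoundaryMeasure

variable {m n : ℕ} {M : Type*} [TopologicalSpace M] [ChartedSpace (EuclideanHalfSpace (m + 1)) M]

/-- The inclusion `ℝ^m → ℝ^(m+1)`, `y ↦ (0, y)`, onto the boundary of the half-space. -/
def face (y : EuclideanSpace ℝ (Fin m)) : EuclideanSpace ℝ (Fin (m + 1)) :=
  WithLp.toLp 2 (Fin.cons (0 : ℝ) (fun a => y a))

/-- The part of `ℝ^m` that parametrizes the boundary of `M` in the preferred chart at `p`. -/
def boundaryDomain (p : M) : Set (EuclideanSpace ℝ (Fin m)) :=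
  face ⁻¹' (extChartAt (𝓡∂ (m + 1)) p).target

/-- The parametrization of the boundary of `M` in the preferred chart at `p`. -/
def boundaryParam (p : M) (y : EuclideanSpace ℝ (Fin m)) : M :=
  (extChartAt (𝓡∂ (m + 1)) p).symm (face y)

/-- The metric on the boundary of `M` induced by `φ`, `g_ab = ⟨∂_a φ, ∂_b φ⟩`, in the preferred
chart at `p`. -/
def boundaryMetric (φ : M → EuclideanSpace ℝ (Fin n)) (p : M) (y : EuclideanSpace ℝ (Fin m)) :
    Matrix (Fin m) (Fin m) ℝ :=
  Matrix.of fun a b => inner ℝ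
    (fderiv ℝ (fun z => φ (boundaryParam p z)) y (EuclideanSpace.single a 1))
    (fderiv ℝ (fun z => φ (boundaryParam p z)) y (EuclideanSpace.single b 1))

variable (m M) in
/-- A smooth partition of unity subordinate to the cover of `M` by the domains of the preferred
charts. -/
def chartPartition [IsManifold (𝓡∂ (m + 1)) ∞ M] [T2Space M] [SigmaCompactSpace M] :
    SmoothPartitionOfUnity M (𝓡∂ (m + 1)) M Set.univ :=
  (SmoothPartitionOfUnity.exists_isSubordinate_chartAt_source (𝓡∂ (m + 1)) M).choose

variable (m) in
/-- The `m`-dimensional measure `ds` induced by `φ` on the boundary of `M`, as a measure on `M`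
carried by the boundary.  It is the Riemannian measure of the induced metric: in the chart at `p`
it is `√(det g) dy`, and these local measures are glued by means of a partition of unity `ρ`, that
is, `∫ f ds = ∑_p ∫ ρ_p f √(det g) dy`. -/
def boundaryMeasure [IsManifold (𝓡∂ (m + 1)) ∞ M] [T2Space M] [SigmaCompactSpace M]
    [MeasurableSpace M] (φ : M → EuclideanSpace ℝ (Fin n)) : MeasureTheory.Measure M :=
  MeasureTheory.Measure.sum fun p : M =>
    MeasureTheory.Measure.map (boundaryParam p)
      ((MeasureTheory.volume.restrict (boundaryDomain (m := m) p)).withDensity fun y =>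
        ENNReal.ofReal (chartPartition m M p (boundaryParam p y) *
          √(boundaryMetric φ p y).det))

end BoundaryMeasure

end FreeBoundary

end

/-! On a minimal submanifold every coordinate function `⟨φ, e⟩` is harmonic for the induced metric.
Its outward normal derivative along the boundary is `⟨ν, e⟩`, and the free boundary condition gives
`ν = φ`. The divergence theorem then yields `∫_∂Σ ⟨φ, e⟩ ds = ∫_Σ Δ⟨φ, e⟩ = 0`.

The argument is carried out in coordinates. Let `A` be the derivative of `φ` in a chart and `G` its
Gram matrix. The gradient of `⟨φ, e⟩` is `tangentialCoord A e = G⁻¹Aᵀe`, and harmonicity says that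
`√(det G)` times this gradient (`gradientFlux`) has zero Euclidean divergence. This is
`sum_fderiv_volumeDensity_smul_tangentialCoord`: minimality makes the `G`-trace of the second
derivative tangential, hence orthogonal to the normal part of `e`, and what remains cancels against
the derivative of `√(det G)`.

Minimality and the conormal condition are given at each point only in that point's own preferred
chart. `exists_trace_eq_chartDeriv` and `chartDeriv_conormalCoord` carry them to every point of
every preferred chart. The latter also settles the sign: `φ` stays in the ball, so the outward
conormal is `φ` and not `-φ`.

No volume measure on `M` is needed to globalize. For a partition of unity `ρ_p`, Green's formula in
the chart at `p` (`setIntegral_chartDeriv_gradientFlux`) turns `∫ ρ_p ⟨φ, e⟩ ds` into a chart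
integral of `dρ_p` applied to the flux. That integrand transforms as a density, so its pieces can be
moved between charts, and they add up to zero because `∑ dρ_p = 0`
(`sum_setIntegral_chartDeriv_gradientFlux`). -/

noncomputable section

namespace FreeBoundary

open MeasureTheory Set

/-! ### Linear algebra of the induced metric -/

section Gram

variable {k : ℕ} {V : Type*} [NormedAddCommGroup V] [InnerProductSpace ℝ V]

/-- The Gram matrix of the images of the standard basis vectors under `A`. -/
def gramMatrix (A : EuclideanSpace ℝ (Fin k) →L[ℝ] V) : Matrix (Fin k) (Fin k) ℝ :=
  Matrix.gram ℝ fun a => A (EuclideanSpace.single a 1)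

/-- The factor by which `A` scales `k`-dimensional volumes. -/
def volumeDensity (A : EuclideanSpace ℝ (Fin k) →L[ℝ] V) : ℝ := √(gramMatrix A).det

/-- The coordinates of the orthogonal projection of `e` to the range of `A`. -/
def tangentialCoord (A : EuclideanSpace ℝ (Fin k) →L[ℝ] V) (e : V) : EuclideanSpace ℝ (Fin k) :=
  WithLp.toLp 2 ((gramMatrix A)⁻¹.mulVec fun a => inner ℝ (A (EuclideanSpace.single a 1)) e)

theorem gramMatrix_apply (A : EuclideanSpace ℝ (Fin k) →L[ℝ] V) (a b : Fin k) :
    gramMatrix A a b = inner ℝ (A (EuclideanSpace.single a 1)) (A (EuclideanSpace.single b 1)) :=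
  rfl

theorem sum_coord_smul_single (u : EuclideanSpace ℝ (Fin k)) :
    ∑ a, u a • (EuclideanSpace.single a 1 : EuclideanSpace ℝ (Fin k)) = u := by
  have := (EuclideanSpace.basisFun (Fin k) ℝ).sum_repr u
  simpa using this

theorem map_eq_sum {W : Type*} [AddCommGroup W] [Module ℝ W] [TopologicalSpace W]
    (A : EuclideanSpace ℝ (Fin k) →L[ℝ] W)
    (u : EuclideanSpace ℝ (Fin k)) : A u = ∑ a, u a • A (EuclideanSpace.single a 1) := by
  conv_lhs => rw [← sum_coord_smul_single u]
  simp

theorem inner_map_map (A : EuclideanSpace ℝ (Fin k) →L[ℝ] V) (u v : EuclideanSpace ℝ (Fin k)) :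
    inner ℝ (A u) (A v) = ∑ a, ∑ b, u a * gramMatrix A a b * v b := by
  rw [map_eq_sum A u, map_eq_sum A v, sum_inner]
  refine Finset.sum_congr rfl fun a _ => ?_
  rw [inner_sum]
  refine Finset.sum_congr rfl fun b _ => ?_
  rw [real_inner_smul_left, real_inner_smul_right, gramMatrix_apply]
  ring

theorem gramMatrix_isSymm (A : EuclideanSpace ℝ (Fin k) →L[ℝ] V) : (gramMatrix A).IsSymm :=
  Matrix.ext fun _ _ => real_inner_comm _ _

theorem gramMatrix_posDef {A : EuclideanSpace ℝ (Fin k) →L[ℝ] V} (hA : Function.Injective A) :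
    (gramMatrix A).PosDef := by
  refine Matrix.posDef_gram_of_linearIndependent ?_
  have h := (EuclideanSpace.basisFun (Fin k) ℝ).toBasis.linearIndependent
  have := h.map' A.toLinearMap (LinearMap.ker_eq_bot.2 hA)
  have e : (fun a => A (EuclideanSpace.single a 1)) =
      A.toLinearMap ∘ (EuclideanSpace.basisFun (Fin k) ℝ).toBasis := by
    ext a
    simp
  rw [e]
  exact this

theorem isUnit_det_gramMatrix {A : EuclideanSpace ℝ (Fin k) →L[ℝ] V}
    (hA : Function.Injective A) : IsUnit (gramMatrix A).det :=
  (gramMatrix_posDef hA).det_pos.ne'.isUnit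

theorem volumeDensity_pos {A : EuclideanSpace ℝ (Fin k) →L[ℝ] V} (hA : Function.Injective A) :
    0 < volumeDensity A :=
  Real.sqrt_pos.2 (gramMatrix_posDef hA).det_pos

/-- These are the normal equations `G w = Aᵀe` of the projection of `e` to the range of `A`. -/
theorem inner_map_single_tangentialCoord {A : EuclideanSpace ℝ (Fin k) →L[ℝ] V}
    (hA : Function.Injective A) (e : V) (a : Fin k) :
    inner ℝ (A (EuclideanSpace.single a 1)) (A (tangentialCoord A e)) =
      inner ℝ (A (EuclideanSpace.single a 1)) e := by
  have h : (gramMatrix A).mulVec (tangentialCoord A e).ofLp =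
      fun a => inner ℝ (A (EuclideanSpace.single a 1)) e := by
    simp only [tangentialCoord, Matrix.mulVec_mulVec]
    rw [Matrix.mul_nonsing_inv _ (isUnit_det_gramMatrix hA), Matrix.one_mulVec]
  rw [← congrFun h a, map_eq_sum A (tangentialCoord A e), inner_sum]
  simp only [real_inner_smul_right, Matrix.mulVec, dotProduct, gramMatrix_apply]
  exact Finset.sum_congr rfl fun b _ => mul_comm _ _

theorem inner_map_tangentialCoord {A : EuclideanSpace ℝ (Fin k) →L[ℝ] V}
    (hA : Function.Injective A) (e : V) (u : EuclideanSpace ℝ (Fin k)) :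
    inner ℝ (A u) (A (tangentialCoord A e)) = inner ℝ (A u) e := by
  rw [map_eq_sum A u]
  simp only [sum_inner, real_inner_smul_left, inner_map_single_tangentialCoord hA]

theorem eq_tangentialCoord {A : EuclideanSpace ℝ (Fin k) →L[ℝ] V}
    (hA : Function.Injective A) (e : V) (w : EuclideanSpace ℝ (Fin k))
    (hw : ∀ u, inner ℝ (A u) (A w) = inner ℝ (A u) e) : w = tangentialCoord A e := by
  apply hA
  rw [← sub_eq_zero, ← map_sub, ← inner_self_eq_zero (𝕜 := ℝ)]
  rw [show A (w - tangentialCoord A e) = A w - A (tangentialCoord A e) from map_sub _ _ _,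
    inner_sub_right, ← map_sub, hw, inner_map_tangentialCoord hA, sub_self]

theorem tangentialCoord_map {A : EuclideanSpace ℝ (Fin k) →L[ℝ] V} (hA : Function.Injective A)
    (v : EuclideanSpace ℝ (Fin k)) : tangentialCoord A (A v) = v :=
  (eq_tangentialCoord hA _ _ fun _ => rfl).symm

/-- The gradient transforms as a vector under a change of coordinates `J`, because the normal
equations determine it uniquely. -/
theorem map_tangentialCoord_comp {A : EuclideanSpace ℝ (Fin k) →L[ℝ] V}
    (hA : Function.Injective A) (J : EuclideanSpace ℝ (Fin k) →L[ℝ] EuclideanSpace ℝ (Fin k))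
    (hJ : Function.Bijective J) (e : V) :
    J (tangentialCoord (A ∘L J) e) = tangentialCoord A e := by
  refine eq_tangentialCoord hA e _ fun u => ?_
  obtain ⟨v, rfl⟩ := hJ.2 u
  exact inner_map_tangentialCoord (A := A ∘L J) (hA.comp hJ.1) e v

/-- The Gram matrix becomes `Jᵀ G J`, whose determinant is `(det J)² det G`. -/
theorem volumeDensity_comp (A : EuclideanSpace ℝ (Fin k) →L[ℝ] V)
    (J : EuclideanSpace ℝ (Fin k) →L[ℝ] EuclideanSpace ℝ (Fin k)) :
    volumeDensity (A ∘L J) = |J.det| * volumeDensity A := by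
  let b := (EuclideanSpace.basisFun (Fin k) ℝ).toBasis
  let N := LinearMap.toMatrix b b J.toLinearMap
  have hN : N.det = J.det := LinearMap.det_toMatrix b _
  have hNa : ∀ c a, N c a = J (EuclideanSpace.single a 1) c := fun c a => by
    simp [N, b, LinearMap.toMatrix_apply]
  have h : gramMatrix (A ∘L J) = N.transpose * gramMatrix A * N := by
    ext a b
    rw [gramMatrix_apply, ContinuousLinearMap.comp_apply, ContinuousLinearMap.comp_apply,
      inner_map_map]
    simp only [Matrix.mul_apply, Matrix.transpose_apply, hNa, Finset.sum_mul]
    rw [Finset.sum_comm]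
  rw [volumeDensity, h, Matrix.det_mul, Matrix.det_mul, Matrix.det_transpose, hN,
    show J.det * (gramMatrix A).det * J.det = J.det ^ 2 * (gramMatrix A).det by ring,
    Real.sqrt_mul (sq_nonneg _), Real.sqrt_sq_eq_abs, volumeDensity]

/-- The trace of a bilinear form with respect to the induced metric. -/
theorem sum_frame_eq_sum_gramMatrix_inv {W : Type*} [NormedAddCommGroup W] [NormedSpace ℝ W]
    {A : EuclideanSpace ℝ (Fin k) →L[ℝ] V}
    (B : EuclideanSpace ℝ (Fin k) →L[ℝ] EuclideanSpace ℝ (Fin k) →L[ℝ] W)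
    {ι : Type*} [Fintype ι] [DecidableEq ι] (hι : Fintype.card ι = k)
    (u : ι → EuclideanSpace ℝ (Fin k)) (hu : Orthonormal ℝ fun j => A (u j)) :
    ∑ j, B (u j) (u j) = ∑ a, ∑ b, (gramMatrix A)⁻¹ a b •
      B (EuclideanSpace.single a 1) (EuclideanSpace.single b 1) := by
  let U : Matrix (Fin k) ι ℝ := Matrix.of fun a j => u j a
  have h1 : (U.transpose * gramMatrix A) * U = 1 := by
    ext i j
    have := orthonormal_iff_ite.1 hu i j
    rw [inner_map_map, Finset.sum_comm] at this
    rw [Matrix.one_apply, ← this]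
    simp only [Matrix.mul_apply, Matrix.transpose_apply, Finset.sum_mul, U, Matrix.of_apply]
  -- `U` is square up to reindexing, so `UᵀG` is also its right inverse. Thus `U Uᵀ G = 1`, that is,
  -- `G⁻¹ = U Uᵀ`.
  replace h1 := (Matrix.mul_eq_one_comm_of_card_eq _ _ _ (by simpa using hι)).1 h1
  rw [← Matrix.mul_assoc] at h1
  have h2 : (gramMatrix A)⁻¹ = U * U.transpose := Matrix.inv_eq_left_inv h1
  have h3 : ∀ j, B (u j) (u j) = ∑ a, ∑ b, (u j a * u j b) •
      B (EuclideanSpace.single a 1) (EuclideanSpace.single b 1) := fun j => by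
    conv_lhs => rw [map_eq_sum B (u j)]
    simp only [sum_apply, smul_apply]
    refine Finset.sum_congr rfl fun a _ => ?_
    rw [map_eq_sum (B _) (u j), Finset.smul_sum]
    simp only [smul_smul]
  simp only [h2, h3, Matrix.mul_apply, Matrix.transpose_apply, U, Matrix.of_apply,
    Finset.sum_smul]
  rw [Finset.sum_comm]
  exact Finset.sum_congr rfl fun a _ => Finset.sum_comm

end Gram

/-! ### The conormal of the coordinate hyperplane `x 0 = 0`. -/

section Conormal

variable {m : ℕ} {V : Type*} [NormedAddCommGroup V] [InnerProductSpace ℝ V]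

/-- The vector of the domain of `A` dual to the first coordinate for the induced metric. -/
def conormalCoord (A : EuclideanSpace ℝ (Fin (m + 1)) →L[ℝ] V) : EuclideanSpace ℝ (Fin (m + 1)) :=
  WithLp.toLp 2 ((gramMatrix A)⁻¹.mulVec (Pi.single 0 1))

/-- `conormalCoord A` is the Riemannian gradient of the coordinate `x 0`. Its image is therefore
orthogonal to the image of the hyperplane `u 0 = 0`, and it points into the half-space. -/
theorem inner_map_conormalCoord {A : EuclideanSpace ℝ (Fin (m + 1)) →L[ℝ] V}
    (hA : Function.Injective A) (u : EuclideanSpace ℝ (Fin (m + 1))) :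
    inner ℝ (A u) (A (conormalCoord A)) = u 0 := by
  have h : (gramMatrix A).mulVec (conormalCoord A).ofLp = Pi.single 0 1 := by
    simp only [conormalCoord, Matrix.mulVec_mulVec]
    rw [Matrix.mul_nonsing_inv _ (isUnit_det_gramMatrix hA), Matrix.one_mulVec]
  have h2 : ∀ a, ∑ b, u a * gramMatrix A a b * conormalCoord A b =
      u a * (Pi.single 0 1 : Fin (m + 1) → ℝ) a := fun a => by
    rw [← congrFun h a]
    simp only [Matrix.mulVec, dotProduct, Finset.mul_sum, mul_assoc]
  rw [inner_map_map]
  simp [h2, Pi.single_apply]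

theorem conormalCoord_zero (A : EuclideanSpace ℝ (Fin (m + 1)) →L[ℝ] V) :
    conormalCoord A 0 = (gramMatrix A)⁻¹ 0 0 := by
  simp [conormalCoord]

theorem norm_map_conormalCoord_sq {A : EuclideanSpace ℝ (Fin (m + 1)) →L[ℝ] V}
    (hA : Function.Injective A) : ‖A (conormalCoord A)‖ ^ 2 = conormalCoord A 0 := by
  rw [← real_inner_self_eq_norm_sq, inner_map_conormalCoord hA]

theorem conormalCoord_zero_pos {A : EuclideanSpace ℝ (Fin (m + 1)) →L[ℝ] V}
    (hA : Function.Injective A) : 0 < conormalCoord A 0 := by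
  rw [← norm_map_conormalCoord_sq hA]
  have : A (conormalCoord A) ≠ 0 := fun h => by
    have := inner_map_conormalCoord hA (EuclideanSpace.single 0 1)
    simp [h] at this
  positivity

theorem tangentialCoord_zero_eq_inner {A : EuclideanSpace ℝ (Fin (m + 1)) →L[ℝ] V}
    (hA : Function.Injective A) (e : V) :
    tangentialCoord A e 0 = inner ℝ (A (conormalCoord A)) e := by
  rw [← inner_map_tangentialCoord hA, real_inner_comm, inner_map_conormalCoord hA]

/-- By Cramer's rule `det G · (G⁻¹)₀₀` is the minor of `G` with row and column `0` deleted. This is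
what turns the interior density into the boundary density. -/
theorem volumeDensity_mul_norm_conormal {A : EuclideanSpace ℝ (Fin (m + 1)) →L[ℝ] V}
    (hA : Function.Injective A) :
    volumeDensity A * ‖A (conormalCoord A)‖ =
      √((gramMatrix A).submatrix Fin.succ Fin.succ).det := by
  have hd := (gramMatrix_posDef hA).det_pos
  rw [← Real.sqrt_sq (norm_nonneg (A (conormalCoord A))), norm_map_conormalCoord_sq hA,
    conormalCoord_zero, volumeDensity, ← Real.sqrt_mul hd.le, Matrix.inv_def, Ring.inverse_eq_inv',
    Matrix.smul_apply, smul_eq_mul, mul_inv_cancel_left₀ hd.ne',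
    Matrix.adjugate_fin_succ_eq_det_submatrix]
  simp

end Conormal

/-! ### Derivatives of the induced metric -/

section Calculus

variable {X : Type*} [NormedAddCommGroup X] [NormedSpace ℝ X]

theorem contDiffAt_matrix_det {ι : Type*} [Fintype ι] [DecidableEq ι] {r : WithTop ℕ∞}
    {f : X → Matrix ι ι ℝ} {x : X} (h : ∀ a b, ContDiffAt ℝ r (fun y => f y a b) x) :
    ContDiffAt ℝ r (fun y => (f y).det) x := by
  simp only [Matrix.det_apply']
  exact ContDiffAt.sum fun σ _ => contDiffAt_const.mul (contDiffAt_prod fun i _ => h _ _)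

theorem contDiffAt_matrix_inv {ι : Type*} [Fintype ι] [DecidableEq ι] {r : WithTop ℕ∞}
    {f : X → Matrix ι ι ℝ} {x : X} (h : ∀ a b, ContDiffAt ℝ r (fun y => f y a b) x)
    (hx : (f x).det ≠ 0) (a b : ι) : ContDiffAt ℝ r (fun y => (f y)⁻¹ a b) x := by
  simp only [Matrix.inv_def, Ring.inverse_eq_inv', Matrix.smul_apply, smul_eq_mul,
    Matrix.adjugate_apply]
  refine ((contDiffAt_matrix_det h).inv hx).mul (contDiffAt_matrix_det fun c d => ?_)
  simp only [Matrix.updateRow_apply]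
  split_ifs
  · exact contDiffAt_const
  · exact h c d

theorem det_updateRow_eq_sum_adjugate {ι : Type*} [Fintype ι] [DecidableEq ι] (N : Matrix ι ι ℝ)
    (i : ι) (v : ι → ℝ) : (N.updateRow i v).det = ∑ j, N.adjugate j i * v j := by
  rw [← Matrix.cramer_transpose_apply, Matrix.cramer_eq_adjugate_mulVec,
    ← Matrix.adjugate_transpose]
  rfl

/-- Jacobi's formula for the derivative of the determinant. -/
theorem hasFDerivAt_matrix_det {ι : Type*} [Fintype ι] [DecidableEq ι] {f : X → Matrix ι ι ℝ}
    {f' : ι → ι → X →L[ℝ] ℝ} {x : X} (h : ∀ a b, HasFDerivAt (fun y => f y a b) (f' a b) x) :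
    HasFDerivAt (fun y => (f y).det) (∑ a, ∑ b, (f x).adjugate b a • f' a b) x := by
  let D : ContinuousMultilinearMap ℝ (fun _ : ι => ι → ℝ) ℝ :=
    { (Matrix.detRowAlternating : (ι → ℝ) [⋀^ι]→ₗ[ℝ] ℝ).toMultilinearMap with
      cont := (continuous_id.matrix_det : Continuous fun N : Matrix ι ι ℝ => N.det) }
  have hr : ∀ a, HasFDerivAt (fun y b => f y a b) (ContinuousLinearMap.pi (f' a)) x :=
    fun a => hasFDerivAt_pi.2 (h a)
  -- The determinant is multilinear in the rows, so its derivative replaces one row at a time;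
  -- expanding along the replaced row produces the adjugate.
  refine (HasFDerivAt.multilinear_comp D hr).congr_fderiv ?_
  ext v
  simp only [sum_apply, ContinuousLinearMap.comp_apply, smul_apply, smul_eq_mul]
  refine Finset.sum_congr rfl fun a _ => ?_
  rw [← det_updateRow_eq_sum_adjugate (f x) a fun b => f' a b v]
  rfl

variable {k : ℕ} {V : Type*} [NormedAddCommGroup V] [InnerProductSpace ℝ V]

theorem contDiff_gramMatrix (a b : Fin k) : ContDiff ℝ ∞
    fun A : EuclideanSpace ℝ (Fin k) →L[ℝ] V => gramMatrix A a b := by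
  simp only [gramMatrix_apply]
  exact ContDiff.inner ℝ (by fun_prop) (by fun_prop)

theorem continuous_volumeDensity :
    Continuous (volumeDensity : (EuclideanSpace ℝ (Fin k) →L[ℝ] V) → ℝ) := by
  refine Real.continuous_sqrt.comp
    (contDiff_iff_contDiffAt.2 fun A => ?_ : ContDiff ℝ ∞ _).continuous
  exact contDiffAt_matrix_det fun a b => (contDiff_gramMatrix a b).contDiffAt

theorem contDiffAt_volumeDensity {A : EuclideanSpace ℝ (Fin k) →L[ℝ] V}
    (hA : Function.Injective A) : ContDiffAt ℝ ∞ volumeDensity A :=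
  (contDiffAt_matrix_det fun a b => (contDiff_gramMatrix a b).contDiffAt).sqrt
    (gramMatrix_posDef hA).det_pos.ne'

theorem contDiffAt_tangentialCoord {A : EuclideanSpace ℝ (Fin k) →L[ℝ] V}
    (hA : Function.Injective A) (e : V) : ContDiffAt ℝ ∞ (fun A => tangentialCoord A e) A := by
  refine contDiffAt_euclidean.2 fun a => ?_
  change ContDiffAt ℝ ∞ (fun A : EuclideanSpace ℝ (Fin k) →L[ℝ] V =>
    ∑ b, (gramMatrix A)⁻¹ a b * inner ℝ (A (EuclideanSpace.single b 1)) e) A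
  refine ContDiffAt.sum fun b _ => ?_
  exact (contDiffAt_matrix_inv (fun a b => (contDiff_gramMatrix a b).contDiffAt)
    (gramMatrix_posDef hA).det_pos.ne' a b).mul (ContDiffAt.inner ℝ (by fun_prop) (by fun_prop))

/-- Jacobi's formula gives `½ √(det G) tr(G⁻¹ ∂G)`. Both halves of `∂⟨A e_a, A e_b⟩` contribute the
same amount because `G⁻¹` is symmetric, which removes the factor `½`. -/
theorem fderiv_volumeDensity_apply {A : X → EuclideanSpace ℝ (Fin k) →L[ℝ] V}
    {A' : X →L[ℝ] EuclideanSpace ℝ (Fin k) →L[ℝ] V} {x : X} (h : HasFDerivAt A A' x)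
    (hA : Function.Injective (A x)) (v : X) :
    fderiv ℝ (fun y => volumeDensity (A y)) x v = volumeDensity (A x) * ∑ a, ∑ b,
      (gramMatrix (A x))⁻¹ a b * inner ℝ (A' v (EuclideanSpace.single a 1))
        (A x (EuclideanSpace.single b 1)) := by
  have hd := (gramMatrix_posDef hA).det_pos
  have hg : ∀ a, HasFDerivAt (fun y => A y (EuclideanSpace.single a 1))
      ((ContinuousLinearMap.apply ℝ V (EuclideanSpace.single a 1)).comp A') x := fun a =>
    HasFDerivAt.comp (g := fun B : EuclideanSpace ℝ (Fin k) →L[ℝ] V => B (EuclideanSpace.single a 1))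
      x (ContinuousLinearMap.apply ℝ V (EuclideanSpace.single a 1)).hasFDerivAt h
  have h1 := (hasFDerivAt_matrix_det (f := fun y => gramMatrix (A y)) fun a b =>
    (hg a).inner ℝ (hg b)).sqrt hd.ne'
  rw [show (fun y => volumeDensity (A y)) = fun y => √(gramMatrix (A y)).det from rfl, h1.fderiv]
  have hs : √(gramMatrix (A x)).det ≠ 0 := (Real.sqrt_pos.2 hd).ne'
  have hinv : ∀ a b, (gramMatrix (A x)).adjugate a b =
      √(gramMatrix (A x)).det * √(gramMatrix (A x)).det * (gramMatrix (A x))⁻¹ a b := fun a b => by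
    rw [Real.mul_self_sqrt hd.le, Matrix.inv_def, Ring.inverse_eq_inv', Matrix.smul_apply,
      smul_eq_mul, mul_inv_cancel_left₀ hd.ne']
  have hsymm : ∀ a b, (gramMatrix (A x))⁻¹ a b = (gramMatrix (A x))⁻¹ b a := fun a b =>
    ((gramMatrix_isSymm (A x)).inv.apply b a)
  simp only [smul_apply, sum_apply, smul_eq_mul, ContinuousLinearMap.comp_apply,
    ContinuousLinearMap.prod_apply, fderivInnerCLM_apply, ContinuousLinearMap.apply_apply, hinv,
    mul_add, Finset.sum_add_distrib]
  have e1 : ∑ a, ∑ b, √(gramMatrix (A x)).det * √(gramMatrix (A x)).det *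
      (gramMatrix (A x))⁻¹ b a * inner ℝ (A x (EuclideanSpace.single a 1))
        (A' v (EuclideanSpace.single b 1)) = √(gramMatrix (A x)).det * √(gramMatrix (A x)).det *
      ∑ a, ∑ b, (gramMatrix (A x))⁻¹ a b * inner ℝ (A' v (EuclideanSpace.single a 1))
        (A x (EuclideanSpace.single b 1)) := by
    rw [Finset.sum_comm]
    simp only [Finset.mul_sum, real_inner_comm, mul_assoc]
  have e2 : ∑ a, ∑ b, √(gramMatrix (A x)).det * √(gramMatrix (A x)).det *
      (gramMatrix (A x))⁻¹ b a * inner ℝ (A' v (EuclideanSpace.single a 1))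
        (A x (EuclideanSpace.single b 1)) = √(gramMatrix (A x)).det * √(gramMatrix (A x)).det *
      ∑ a, ∑ b, (gramMatrix (A x))⁻¹ a b * inner ℝ (A' v (EuclideanSpace.single a 1))
        (A x (EuclideanSpace.single b 1)) := by
    simp only [Finset.mul_sum, mul_assoc]
    exact Finset.sum_congr rfl fun a _ => Finset.sum_congr rfl fun b _ => by rw [hsymm]
  rw [e1, e2, volumeDensity]
  field_simp
  ring

/-- Injectivity of `A` amounts to `det G ≠ 0`, an open condition. -/
theorem eventually_injective {A₀ : EuclideanSpace ℝ (Fin k) →L[ℝ] V}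
    (hA : Function.Injective A₀) :
    ∀ᶠ A : EuclideanSpace ℝ (Fin k) →L[ℝ] V in 𝓝 A₀, Function.Injective A := by
  have h : ContinuousAt volumeDensity A₀ := continuous_volumeDensity.continuousAt
  filter_upwards [h.eventually (lt_mem_nhds (volumeDensity_pos hA))] with A h
  have h2 : (gramMatrix A).det ≠ 0 := fun h0 => by simp [volumeDensity, h0] at h
  refine (injective_iff_map_eq_zero A).2 fun u hu => ?_
  have h3 : (gramMatrix A).mulVec u.ofLp = 0 := by
    ext a
    have : inner ℝ (A (EuclideanSpace.single a 1)) (A u) = ∑ b, gramMatrix A a b * u b := by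
      rw [map_eq_sum A u, inner_sum]
      simp only [real_inner_smul_right, gramMatrix_apply, mul_comm]
    rw [hu, inner_zero_right] at this
    exact this.symm
  have := Matrix.eq_zero_of_mulVec_eq_zero h2 h3
  ext a
  exact congrFun this a

/-- If the trace of the second derivative of `F` is tangential, then the Laplacian of the coordinate
functions of `F` vanishes: the field `√(det g) grad ⟨F, e⟩` is divergence free. -/
theorem sum_fderiv_volumeDensity_smul_tangentialCoord {F : EuclideanSpace ℝ (Fin k) → V}
    {x : EuclideanSpace ℝ (Fin k)} (hF : ContDiffAt ℝ 2 F x)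
    (hA : Function.Injective (fderiv ℝ F x)) (e : V)
    (hH : ∃ u, ∑ a, ∑ b, (gramMatrix (fderiv ℝ F x))⁻¹ a b • fderiv ℝ (fderiv ℝ F) x
      (EuclideanSpace.single a 1) (EuclideanSpace.single b 1) = fderiv ℝ F x u) :
    DifferentiableAt ℝ (fun y => volumeDensity (fderiv ℝ F y) • tangentialCoord (fderiv ℝ F y) e) x ∧
    ∑ a, fderiv ℝ (fun y => volumeDensity (fderiv ℝ F y) • tangentialCoord (fderiv ℝ F y) e) x
      (EuclideanSpace.single a 1) a = 0 := by
  set A := fderiv ℝ F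
  set A' := fderiv ℝ A x with hA'def
  have hAd : HasFDerivAt A A' x :=
    ((hF.fderiv_right (m := 1) le_rfl).differentiableAt one_ne_zero).hasFDerivAt
  have hsymm : ∀ u v, A' u v = A' v u := fun u v =>
    (hF.isSymmSndFDerivAt (by simp)).eq u v
  have hG : DifferentiableAt ℝ (fun y => volumeDensity (A y)) x :=
    ((contDiffAt_volumeDensity hA).differentiableAt (by simp)).comp x hAd.differentiableAt
  have hw : DifferentiableAt ℝ (fun y => tangentialCoord (A y) e) x :=
    DifferentiableAt.comp (g := fun A => tangentialCoord A e) x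
      ((contDiffAt_tangentialCoord hA e).differentiableAt (by simp)) hAd.differentiableAt
  set w := tangentialCoord (A x) e
  set W := fderiv ℝ (fun y => tangentialCoord (A y) e) x
  refine ⟨hG.smul hw, ?_⟩
  -- Obtained by differentiating the normal equations `⟨A u, A w⟩ = ⟨A u, e⟩` in the direction `h`;
  -- they hold on a whole neighbourhood of `x`.
  have hW : ∀ h u, inner ℝ (A x u) (A x (W h)) =
      inner ℝ (A' h u) (e - A x w) - inner ℝ (A x u) (A' h w) := by
    intro h u
    have h1 : HasFDerivAt (fun y => A y u) ((ContinuousLinearMap.apply ℝ V u).comp A') x :=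
      (ContinuousLinearMap.hasFDerivAt (ContinuousLinearMap.apply ℝ V u)).comp x hAd
    have h2 := h1.inner ℝ (hAd.clm_apply hw.hasFDerivAt)
    have h3 := h1.inner ℝ (hasFDerivAt_const e x)
    have h4 : (fun y => inner ℝ (A y u) (A y (tangentialCoord (A y) e))) =ᶠ[𝓝 x]
        fun y => inner ℝ (A y u) e := by
      filter_upwards [hAd.continuousAt.eventually (eventually_injective hA)] with y hy
      exact inner_map_tangentialCoord hy e u
    have h5 := congrArg (fun L => L h) (h2.unique (h3.congr_of_eventuallyEq h4))
    simp [fderivInnerCLM_apply, inner_add_right] at h5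
    rw [inner_sub_right]
    linarith
  have hcoord : ∀ (u : EuclideanSpace ℝ (Fin k)) a,
      u a = ∑ b, (gramMatrix (A x))⁻¹ a b * inner ℝ (A x (EuclideanSpace.single b 1)) (A x u) :=
    fun u a => by
      conv_lhs => rw [← tangentialCoord_map hA u]
      rfl
  -- Contracting `hW` with `G⁻¹` computes the divergence of `w`. The term with `e - A w` drops out,
  -- since the traced second derivative is tangential and `e - A w` is normal. By symmetry of second
  -- derivatives, the other term is minus the logarithmic derivative of `√(det G)` along `w`, which
  -- cancels in the product rule.
  have htr : ∑ a, W (EuclideanSpace.single a 1) a = -∑ a, ∑ b, (gramMatrix (A x))⁻¹ a b *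
      inner ℝ (A' w (EuclideanSpace.single a 1)) (A x (EuclideanSpace.single b 1)) := by
    obtain ⟨u, hu⟩ := hH
    have h0 : inner ℝ (A x u) (e - A x w) = 0 := by
      rw [inner_sub_right, inner_map_tangentialCoord hA, sub_self]
    rw [← hu] at h0
    simp only [sum_inner, real_inner_smul_left] at h0
    simp only [fun a => hcoord (W (EuclideanSpace.single a 1)) a, hW, mul_sub,
      Finset.sum_sub_distrib, hsymm w]
    rw [h0, zero_sub]
    simp only [real_inner_comm]
  have hdG := fderiv_volumeDensity_apply hAd hA w
  rw [fderiv_fun_smul hG hw]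
  simp only [add_apply, smul_apply, ContinuousLinearMap.smulRight_apply, PiLp.add_apply,
    PiLp.smul_apply, smul_eq_mul, Finset.sum_add_distrib]
  rw [← Finset.mul_sum, htr]
  have : fderiv ℝ (fun y => volumeDensity (A y)) x w =
      ∑ a, fderiv ℝ (fun y => volumeDensity (A y)) x (EuclideanSpace.single a 1) * w a := by
    rw [map_eq_sum (fderiv ℝ (fun y => volumeDensity (A y)) x) w]
    simp [mul_comm]
  rw [← this, hdG]
  ring

end Calculus

/-! ### The divergence theorem on the half-space -/

section Divergence

variable {m : ℕ}

theorem fderiv_eq_zero_of_eq_zero_off {E W : Type*} [NormedAddCommGroup E] [NormedSpace ℝ E]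
    [NormedAddCommGroup W] [NormedSpace ℝ W] {X : E → W} {K : Set E} (hK : IsClosed K)
    (hX : ∀ x ∉ K, X x = 0) {x : E} (hx : x ∉ K) : fderiv ℝ X x = 0 := by
  have : X =ᶠ[𝓝 x] fun _ => 0 := by
    filter_upwards [hK.isOpen_compl.mem_nhds hx] with y hy using hX y hy
  rw [this.fderiv_eq, fderiv_fun_const]
  rfl

/-- The divergence theorem is applied on a box of the half-space resting on `x 0 = 0`; `X` vanishes
on all its other faces. Differentiability is asked only for `x 0 > 0`, since chart derivatives are
one-sided on the boundary. -/
theorem integral_divergence_halfSpace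
    {X : EuclideanSpace ℝ (Fin (m + 1)) → EuclideanSpace ℝ (Fin (m + 1))}
    {K : Set (EuclideanSpace ℝ (Fin (m + 1)))} (hK : IsCompact K) (hX : ∀ x ∉ K, X x = 0)
    (hc : ContinuousOn X {x | 0 ≤ x 0}) (hd : ∀ x, 0 < x 0 → DifferentiableAt ℝ X x)
    (hi : IntegrableOn (fun x => ∑ a, fderiv ℝ X x (EuclideanSpace.single a 1) a) {x | 0 < x 0}) :
    ∫ x in {x | 0 < x 0}, ∑ a, fderiv ℝ X x (EuclideanSpace.single a 1) a =
      -∫ y, X (face y) 0 := by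
  obtain ⟨R, hR0, hR⟩ : ∃ R : ℝ, 0 < R ∧ ∀ x ∈ K, ∀ i, |x i| < R := by
    obtain ⟨R, hR⟩ := hK.isBounded.exists_norm_le
    refine ⟨max R 0 + 1, by positivity, fun x hx i => ?_⟩
    calc |x i| ≤ ‖x‖ := PiLp.norm_apply_le x i
      _ ≤ R := hR x hx
      _ < max R 0 + 1 := by linarith [le_max_left R 0]
  have hout : ∀ x : EuclideanSpace ℝ (Fin (m + 1)), (∃ i, R ≤ |x i|) → x ∉ K :=
    fun x ⟨i, hi⟩ hx => (hR x hx i).not_ge hi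
  let L : (Fin (m + 1) → ℝ) ≃L[ℝ] EuclideanSpace ℝ (Fin (m + 1)) :=
    (EuclideanSpace.equiv (Fin (m + 1)) ℝ).symm
  have hL : MeasurePreserving L := PiLp.volume_preserving_toLp (Fin (m + 1))
  have hLe : MeasurableEmbedding L := L.toHomeomorph.measurableEmbedding
  have hLi : ∀ y i, L y i = y i := fun _ _ => rfl
  set D : EuclideanSpace ℝ (Fin (m + 1)) → ℝ :=
    fun x => ∑ a, fderiv ℝ X x (EuclideanSpace.single a 1) a with hD
  have hD0 : ∀ x ∉ K, D x = 0 := fun x hx => by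
    simp [hD, fderiv_eq_zero_of_eq_zero_off hK.isClosed hX hx]
  let f : Fin (m + 1) → (Fin (m + 1) → ℝ) → ℝ := fun a y => X (L y) a
  let f' : Fin (m + 1) → (Fin (m + 1) → ℝ) → (Fin (m + 1) → ℝ) →L[ℝ] ℝ := fun a y =>
    (EuclideanSpace.proj a : EuclideanSpace ℝ (Fin (m + 1)) →L[ℝ] ℝ) ∘L
      (fderiv ℝ X (L y)) ∘L (L : (Fin (m + 1) → ℝ) →L[ℝ] EuclideanSpace ℝ (Fin (m + 1)))
  -- The box is `[0, R] × [-R, R]^m`. As `R` strictly bounds the coordinates on `K`, any point with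
  -- some `|x i| ≥ R` lies off `K`.
  let a : Fin (m + 1) → ℝ := Fin.cons 0 fun _ => -R
  let b : Fin (m + 1) → ℝ := fun _ => R
  have ha0 : a 0 = 0 := rfl
  have has : ∀ i, a (Fin.succ i) = -R := fun i => rfl
  have hab : a ≤ b := fun i => by
    refine Fin.cases ?_ (fun i => ?_) i
    · exact hR0.le
    · simp only [has, b]; linarith
  have hpos : (univ.pi fun i => Ioo (a i) (b i)) ⊆ L ⁻¹' {x | 0 < x 0} := fun y hy => (hy 0 trivial).1
  have hIoo : (univ.pi fun i => Ioo (a i) (b i)) =ᵐ[volume] Icc a b :=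
    Measure.univ_pi_Ioo_ae_eq_Icc
  have hiL : IntegrableOn (fun y => D (L y)) (L ⁻¹' {x | 0 < x 0}) :=
    (hL.integrableOn_comp_preimage hLe).2 hi
  have key := integral_divergence_of_hasFDerivAt_off_countable' a b hab f f' ∅ countable_empty
    (fun i => by
      have h1 : ContinuousOn (fun y => X (L y)) (Icc a b) :=
        hc.comp L.continuous.continuousOn fun y hy => hy.1 0
      exact (EuclideanSpace.proj i :
        EuclideanSpace ℝ (Fin (m + 1)) →L[ℝ] ℝ).continuous.comp_continuousOn h1)
    (fun y hy i => by
      have h1 := (hd (L y) (hpos hy.1)).hasFDerivAt.comp y L.hasFDerivAt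
      exact (EuclideanSpace.proj i : EuclideanSpace ℝ (Fin (m + 1)) →L[ℝ] ℝ).hasFDerivAt.comp y h1)
    ((integrableOn_congr_set_ae hIoo).1 (hiL.mono_set hpos))
  have hleft : ∫ x in {x | 0 < x 0}, D x = ∫ y in Icc a b, ∑ i, f' i y (Pi.single i 1) := by
    rw [← hL.setIntegral_preimage_emb hLe, ← setIntegral_congr_set hIoo]
    refine setIntegral_eq_of_subset_of_forall_sdiff_eq_zero
      (L.continuous.measurable (measurableSet_lt measurable_const (by fun_prop))) hpos
      fun y hy => hD0 _ (hout _ ?_)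
    by_contra! hlt
    refine hy.2 fun i _ => ?_
    have := abs_lt.1 (hlt i)
    refine Fin.cases (fun h => ?_) (fun i h => ?_) i this
    · exact ⟨hy.1, h.2⟩
    · exact ⟨h.1, h.2⟩
  rw [hleft, key, Fin.sum_univ_succ]
  have hfront : ∀ i : Fin (m + 1), ∀ y, f i (i.insertNth (b i) y) = 0 := fun i y => by
    simp only [f]
    rw [hX _ (hout _ ⟨i, by simp [hLi, b, le_abs_self]⟩)]
    rfl
  have hback : ∀ i : Fin m, ∀ y, f i.succ (i.succ.insertNth (a i.succ) y) = 0 := fun i y => by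
    simp only [f]
    rw [hX _ (hout _ ⟨i.succ, by simp [hLi, has, le_abs_self]⟩)]
    rfl
  simp only [hfront, hback, integral_zero, sub_zero, Finset.sum_const_zero, add_zero, zero_sub]
  congr 1
  have hL2 := PiLp.volume_preserving_toLp (Fin m)
  rw [setIntegral_eq_integral_of_forall_compl_eq_zero]
  · rw [← hL2.integral_comp (MeasurableEquiv.toLp 2 (Fin m → ℝ)).measurableEmbedding]
    refine integral_congr_ae (.of_forall fun y => ?_)
    simp only [f, ha0, Fin.insertNth_zero']
    rfl
  · intro y hy
    simp only [f]
    rw [hX _ (hout _ ?_)]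
    · rfl
    by_contra! hlt
    refine hy ⟨fun i => ?_, fun i => ?_⟩
    · have := (abs_lt.1 (hlt i.succ)).1
      simp [hLi, ha0] at this
      simp [has, this.le]
    · have := (abs_lt.1 (hlt i.succ)).2
      simp [hLi, ha0] at this
      simp [b, this.le]

end Divergence

/-! ### Derivatives in charts and changes of charts -/

section Charts

variable {E H M W : Type*} [NormedAddCommGroup E] [NormedSpace ℝ E] [TopologicalSpace H]
  (I : ModelWithCorners ℝ E H) [TopologicalSpace M] [ChartedSpace H M]
  [NormedAddCommGroup W] [NormedSpace ℝ W]

/-- The derivative of `f` in the preferred chart at `p`. -/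
def chartDeriv (f : M → W) (p : M) : E → E →L[ℝ] W :=
  fderivWithin ℝ (f ∘ (extChartAt I p).symm) (range I)

/-- The change of coordinates from the preferred chart at `p` to the preferred chart at `q`. -/
def chartTransition (p q : M) : E → E := extChartAt I q ∘ (extChartAt I p).symm

/-- The derivative of the change of coordinates. -/
def transitionDeriv (p q : M) : E → E →L[ℝ] E := fderivWithin ℝ (chartTransition I p q) (range I)

/-- The part of the chart at `p` that corresponds to the domain of the chart at `q`. -/
def chartOverlap (p q : M) : Set E :=
  (extChartAt I p).target ∩ (extChartAt I p).symm ⁻¹' (extChartAt I q).source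

variable {I}

theorem chartOverlap_mem_nhdsWithin {p q : M} {x : E} (hx : x ∈ chartOverlap I p q) :
    chartOverlap I p q ∈ 𝓝[range I] x := by
  refine Filter.inter_mem (extChartAt_target_mem_nhdsWithin_of_mem hx.1) ?_
  exact ((continuousAt_extChartAt_symm'' hx.1).preimage_mem_nhds
    ((isOpen_extChartAt_source (I := I) q).mem_nhds hx.2) |> mem_nhdsWithin_of_mem_nhds)

theorem isOpen_chartOverlap_inter_interior (p q : M) :
    IsOpen (chartOverlap I p q ∩ interior (range I)) := by
  rw [isOpen_iff_mem_nhds]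
  intro x hx
  have h := chartOverlap_mem_nhdsWithin hx.1
  rw [nhdsWithin_eq_nhds.2 (mem_interior_iff_mem_nhds.1 hx.2)] at h
  exact Filter.inter_mem h (isOpen_interior.mem_nhds hx.2)

theorem mem_range_of_mem_chartOverlap {p q : M} {x : E} (hx : x ∈ chartOverlap I p q) :
    x ∈ range I := extChartAt_target_subset_range p hx.1

theorem extChartAt_symm_chartTransition {p q : M} {x : E} (hx : x ∈ chartOverlap I p q) :
    (extChartAt I q).symm (chartTransition I p q x) = (extChartAt I p).symm x :=
  (extChartAt I q).left_inv hx.2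

theorem chartTransition_mem {p q : M} {x : E} (hx : x ∈ chartOverlap I p q) :
    chartTransition I p q x ∈ chartOverlap I q p := by
  refine ⟨(extChartAt I q).map_source hx.2, ?_⟩
  rw [mem_preimage, extChartAt_symm_chartTransition hx]
  exact (extChartAt I p).map_target hx.1

theorem chartTransition_chartTransition {p q : M} {x : E} (hx : x ∈ chartOverlap I p q) :
    chartTransition I q p (chartTransition I p q x) = x := by
  rw [chartTransition, Function.comp_apply, extChartAt_symm_chartTransition hx,
    (extChartAt I p).right_inv hx.1]

/-- No overlap condition is needed: `extChartAt I q` ends with `I`, so even its values outside the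
chart domain lie in `range I`. -/
theorem mapsTo_chartTransition (p q : M) : MapsTo (chartTransition I p q) (range I) (range I) :=
  fun _ _ => ⟨_, rfl⟩

theorem comp_extChartAt_symm_eventuallyEq {W : Type*} (f : M → W) {p q : M} {x : E}
    (hx : x ∈ chartOverlap I p q) : f ∘ (extChartAt I p).symm =ᶠ[𝓝[range I] x]
      (f ∘ (extChartAt I q).symm) ∘ chartTransition I p q := by
  filter_upwards [chartOverlap_mem_nhdsWithin hx] with y hy
  rw [Function.comp_apply, Function.comp_apply, Function.comp_apply,
    extChartAt_symm_chartTransition hy]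

theorem mem_chartOverlap_self {p : M} {x : E} (hx : x ∈ (extChartAt I p).target) :
    x ∈ chartOverlap I p ((extChartAt I p).symm x) :=
  ⟨hx, mem_extChartAt_source _⟩

theorem chartTransition_self (p : M) (x : E) :
    chartTransition I p ((extChartAt I p).symm x) x =
      extChartAt I ((extChartAt I p).symm x) ((extChartAt I p).symm x) := rfl

theorem mfderiv_eq_chartDeriv {f : M → W} (hf : ContMDiff I 𝓘(ℝ, W) ∞ f) (p : M) :
    (mfderiv I 𝓘(ℝ, W) f p : E →L[ℝ] W) = chartDeriv I f p (extChartAt I p p) := by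
  exact (hf.mdifferentiable (by simp) p).mfderiv

variable [IsManifold I ∞ M]

theorem contDiffWithinAt_chartTransition {p q : M} {x : E} (hx : x ∈ chartOverlap I p q) :
    ContDiffWithinAt ℝ ∞ (chartTransition I p q) (range I) x := by
  refine contDiffWithinAt_ext_coord_change q p ?_
  rw [PartialEquiv.trans_source]
  exact hx

theorem hasFDerivWithinAt_chartTransition {p q : M} {x : E} (hx : x ∈ chartOverlap I p q) :
    HasFDerivWithinAt (chartTransition I p q) (transitionDeriv I p q x) (range I) x :=
  ((contDiffWithinAt_chartTransition hx).differentiableWithinAt (by simp)).hasFDerivWithinAt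

theorem contDiffWithinAt_comp_extChartAt_symm {f : M → W} (hf : ContMDiff I 𝓘(ℝ, W) ∞ f) {p : M}
    {x : E} (hx : x ∈ (extChartAt I p).target) :
    ContDiffWithinAt ℝ ∞ (f ∘ (extChartAt I p).symm) (range I) x := by
  have h := (hf.comp_contMDiffOn (contMDiffOn_extChartAt_symm (I := I) (n := ∞) p)) x hx
  have h2 := contMDiffWithinAt_iff_contDiffWithinAt.1 h
  exact h2.mono_of_mem_nhdsWithin (extChartAt_target_mem_nhdsWithin_of_mem hx)

theorem hasFDerivWithinAt_chartDeriv {f : M → W} (hf : ContMDiff I 𝓘(ℝ, W) ∞ f) {p : M}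
    {x : E} (hx : x ∈ (extChartAt I p).target) :
    HasFDerivWithinAt (f ∘ (extChartAt I p).symm) (chartDeriv I f p x) (range I) x :=
  ((contDiffWithinAt_comp_extChartAt_symm hf hx).differentiableWithinAt
    (by simp)).hasFDerivWithinAt

theorem contDiffWithinAt_chartDeriv {f : M → W} (hf : ContMDiff I 𝓘(ℝ, W) ∞ f) {p : M}
    {x : E} (hx : x ∈ (extChartAt I p).target) :
    ContDiffWithinAt ℝ ∞ (chartDeriv I f p) (range I) x :=
  (contDiffWithinAt_comp_extChartAt_symm hf hx).fderivWithin_right I.uniqueDiffOn (by simp)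
    (extChartAt_target_subset_range p hx)

theorem continuousOn_chartDeriv {f : M → W} (hf : ContMDiff I 𝓘(ℝ, W) ∞ f) (p : M) :
    ContinuousOn (chartDeriv I f p) (extChartAt I p).target := fun _ hx =>
  (contDiffWithinAt_chartDeriv hf hx).continuousWithinAt.mono (extChartAt_target_subset_range p)

theorem chartDeriv_eq_comp {f : M → W} (hf : ContMDiff I 𝓘(ℝ, W) ∞ f) {p q : M} {x : E}
    (hx : x ∈ chartOverlap I p q) : chartDeriv I f p x =
      chartDeriv I f q (chartTransition I p q x) ∘L transitionDeriv I p q x := by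
  have hr := mem_range_of_mem_chartOverlap hx
  have h := (hasFDerivWithinAt_chartDeriv hf (chartTransition_mem hx).1).comp x
    (hasFDerivWithinAt_chartTransition hx) (mapsTo_chartTransition p q)
  exact (h.congr_of_eventuallyEq (comp_extChartAt_symm_eventuallyEq f hx)
    ((comp_extChartAt_symm_eventuallyEq f hx).self_of_nhdsWithin hr)).fderivWithin
      (I.uniqueDiffOn x hr)

theorem transitionDeriv_comp {p q : M} {x : E} (hx : x ∈ chartOverlap I p q) :
    transitionDeriv I q p (chartTransition I p q x) ∘L transitionDeriv I p q x =
      ContinuousLinearMap.id ℝ E := by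
  have hr := mem_range_of_mem_chartOverlap hx
  have h := (hasFDerivWithinAt_chartTransition (chartTransition_mem hx)).comp x
    (hasFDerivWithinAt_chartTransition hx) (mapsTo_chartTransition p q)
  have h2 : (chartTransition I q p ∘ chartTransition I p q) =ᶠ[𝓝[range I] x] id := by
    filter_upwards [chartOverlap_mem_nhdsWithin hx] with y hy
    exact chartTransition_chartTransition hy
  exact (I.uniqueDiffOn x hr).eq h
    ((hasFDerivWithinAt_id x _).congr_of_eventuallyEq h2 (h2.self_of_nhdsWithin hr))

theorem transitionDeriv_bijective {p q : M} {x : E} (hx : x ∈ chartOverlap I p q) :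
    Function.Bijective (transitionDeriv I p q x) := by
  have h1 := transitionDeriv_comp hx
  have h2 := transitionDeriv_comp (chartTransition_mem hx)
  rw [chartTransition_chartTransition hx] at h2
  exact ⟨Function.LeftInverse.injective fun u => DFunLike.congr_fun h1 u,
    Function.RightInverse.surjective fun u => DFunLike.congr_fun h2 u⟩

/-- The second derivatives in two charts differ by a tangential term. -/
theorem fderivWithin_chartDeriv_eq {f : M → W} (hf : ContMDiff I 𝓘(ℝ, W) ∞ f) {p q : M} {x : E}
    (hx : x ∈ chartOverlap I p q) (u v : E) :
    fderivWithin ℝ (chartDeriv I f p) (range I) x u v =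
      fderivWithin ℝ (chartDeriv I f q) (range I) (chartTransition I p q x)
        (transitionDeriv I p q x u) (transitionDeriv I p q x v) +
      chartDeriv I f q (chartTransition I p q x)
        (fderivWithin ℝ (transitionDeriv I p q) (range I) x u v) := by
  have hr := mem_range_of_mem_chartOverlap hx
  have h1 : HasFDerivWithinAt (chartDeriv I f q)
      (fderivWithin ℝ (chartDeriv I f q) (range I) (chartTransition I p q x)) (range I)
      (chartTransition I p q x) :=
    ((contDiffWithinAt_chartDeriv hf (chartTransition_mem hx).1).differentiableWithinAt
      (by simp)).hasFDerivWithinAt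
  have h2 : HasFDerivWithinAt (transitionDeriv I p q)
      (fderivWithin ℝ (transitionDeriv I p q) (range I) x) (range I) x :=
    (((contDiffWithinAt_chartTransition hx).fderivWithin_right (m := ∞) I.uniqueDiffOn (by simp)
      hr).differentiableWithinAt (by simp)).hasFDerivWithinAt
  have h3 := (h1.comp x (hasFDerivWithinAt_chartTransition hx)
    (mapsTo_chartTransition p q)).clm_comp h2
  have h4 : chartDeriv I f p =ᶠ[𝓝[range I] x] fun y =>
      chartDeriv I f q (chartTransition I p q y) ∘L transitionDeriv I p q y := by
    filter_upwards [chartOverlap_mem_nhdsWithin hx] with y hy using chartDeriv_eq_comp hf hy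
  rw [(h3.congr_of_eventuallyEq h4 (h4.self_of_nhdsWithin hr)).fderivWithin (I.uniqueDiffOn x hr)]
  simp [add_comm]

/-- Being an interior point does not depend on the chart. Near these points the chart targets and
`range I` coincide, so their interiors may be exchanged. -/
theorem mem_interior_range_chartTransition_iff {p q : M} {x : E} (hx : x ∈ chartOverlap I p q) :
    chartTransition I p q x ∈ interior (range I) ↔ x ∈ interior (range I) := by
  have h := ModelWithCorners.mem_interior_range_iff_of_mem_atlas (I := I) (n := ∞) (by simp)
    (chart_mem_atlas H q) (chart_mem_atlas H p) (x := (extChartAt I p).symm x)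
    (by simpa [extChartAt] using hx.2)
    (by simpa [extChartAt] using (extChartAt I p).map_target hx.1)
  have h2 : extChartAt I p ((extChartAt I p).symm x) = x := (extChartAt I p).right_inv hx.1
  rw [← (extChartAt_target_eventuallyEq_of_mem (chartTransition_mem hx).1).mem_interior_iff,
    ← (extChartAt_target_eventuallyEq_of_mem hx.1).mem_interior_iff]
  conv_rhs => rw [← h2]
  exact h

/-- Change of variables between two charts. -/
theorem setIntegral_chartOverlap_eq [FiniteDimensional ℝ E] [MeasurableSpace E] [BorelSpace E]
    (μ : Measure E) [μ.IsAddHaarMeasure] (p q : M) (g : E → ℝ) :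
    ∫ x in chartOverlap I q p ∩ interior (range I), g x ∂μ =
      ∫ x in chartOverlap I p q ∩ interior (range I),
        |(transitionDeriv I p q x).det| * g (chartTransition I p q x) ∂μ := by
  have himage : chartTransition I p q '' (chartOverlap I p q ∩ interior (range I)) =
      chartOverlap I q p ∩ interior (range I) := by
    apply Subset.antisymm
    · rintro _ ⟨x, hx, rfl⟩
      exact ⟨chartTransition_mem hx.1, (mem_interior_range_chartTransition_iff hx.1).2 hx.2⟩
    · intro x hx
      exact ⟨chartTransition I q p x, ⟨chartTransition_mem hx.1,
        (mem_interior_range_chartTransition_iff hx.1).2 hx.2⟩,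
        chartTransition_chartTransition hx.1⟩
  rw [← himage, integral_image_eq_integral_abs_det_fderiv_smul μ
    (isOpen_chartOverlap_inter_interior p q).measurableSet
    (fun x hx => (hasFDerivWithinAt_chartTransition hx.1).mono
      (inter_subset_right.trans interior_subset))]
  · rfl
  · intro x hx y hy hxy
    rw [← chartTransition_chartTransition hx.1, hxy, chartTransition_chartTransition hy.1]

end Charts

/-! ### The free boundary and minimality conditions in arbitrary preferred charts -/

section Geometry

variable {m n : ℕ} {M : Type*} [TopologicalSpace M] [ChartedSpace (EuclideanHalfSpace (m + 1)) M]
  {φ : M → EuclideanSpace ℝ (Fin n)}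

theorem mem_range_halfSpace {x : EuclideanSpace ℝ (Fin (m + 1))} :
    x ∈ range (𝓡∂ (m + 1)) ↔ 0 ≤ x 0 := by
  rw [range_modelWithCornersEuclideanHalfSpace]; rfl

theorem mem_interior_range_halfSpace {x : EuclideanSpace ℝ (Fin (m + 1))} :
    x ∈ interior (range (𝓡∂ (m + 1))) ↔ 0 < x 0 := by
  rw [interior_range_modelWithCornersEuclideanHalfSpace]; rfl

theorem differential_eq_chartDeriv (hφ : IsFreeBoundaryMinimal m φ) (p : M) :
    differential φ p = chartDeriv (𝓡∂ (m + 1)) φ p (extChartAt (𝓡∂ (m + 1)) p p) :=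
  mfderiv_eq_chartDeriv hφ.contMDiff p

theorem differential_orthonormalFrame (φ : M → EuclideanSpace ℝ (Fin n)) (p : M)
    (j : Fin (Module.finrank ℝ (tangentPlane (m := m) φ p))) :
    differential φ p (orthonormalFrame φ p j) =
      stdOrthonormalBasis ℝ (tangentPlane (m := m) φ p) j :=
  (LinearMap.mem_range.mp (stdOrthonormalBasis ℝ (tangentPlane (m := m) φ p) j).2).choose_spec

variable [IsManifold (𝓡∂ (m + 1)) ∞ M]

theorem chartDeriv_eq_differential_comp (hφ : IsFreeBoundaryMinimal m φ) {p : M}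
    {x : EuclideanSpace ℝ (Fin (m + 1))} (hx : x ∈ (extChartAt (𝓡∂ (m + 1)) p).target) :
    chartDeriv (𝓡∂ (m + 1)) φ p x = differential φ ((extChartAt (𝓡∂ (m + 1)) p).symm x) ∘L
      transitionDeriv (𝓡∂ (m + 1)) p ((extChartAt (𝓡∂ (m + 1)) p).symm x) x := by
  rw [differential_eq_chartDeriv hφ, chartDeriv_eq_comp hφ.contMDiff (mem_chartOverlap_self hx),
    chartTransition_self]

theorem injective_chartDeriv (hφ : IsFreeBoundaryMinimal m φ) {p : M}
    {x : EuclideanSpace ℝ (Fin (m + 1))} (hx : x ∈ (extChartAt (𝓡∂ (m + 1)) p).target) :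
    Function.Injective (chartDeriv (𝓡∂ (m + 1)) φ p x) := by
  rw [chartDeriv_eq_differential_comp hφ hx]
  exact (hφ.injective_differential _).comp (transitionDeriv_bijective (mem_chartOverlap_self hx)).1

/-- Minimality in an arbitrary preferred chart: the trace of the second derivative is tangential. -/
theorem exists_trace_eq_chartDeriv (hφ : IsFreeBoundaryMinimal m φ) {p : M}
    {x : EuclideanSpace ℝ (Fin (m + 1))} (hx : x ∈ (extChartAt (𝓡∂ (m + 1)) p).target) :
    ∃ u, ∑ a, ∑ b, (gramMatrix (chartDeriv (𝓡∂ (m + 1)) φ p x))⁻¹ a b •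
      fderivWithin ℝ (chartDeriv (𝓡∂ (m + 1)) φ p) (range (𝓡∂ (m + 1))) x
        (EuclideanSpace.single a 1) (EuclideanSpace.single b 1) =
      chartDeriv (𝓡∂ (m + 1)) φ p x u := by
  set q := (extChartAt (𝓡∂ (m + 1)) p).symm x with hq
  have ho := mem_chartOverlap_self hx
  rw [← hq] at ho
  set J := transitionDeriv (𝓡∂ (m + 1)) p q x
  have hA : chartDeriv (𝓡∂ (m + 1)) φ p x = differential φ q ∘L J :=
    chartDeriv_eq_differential_comp hφ hx
  -- The orthonormal frame at `q` is pulled back to the chart at `p`, where it is orthonormal for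
  -- the metric of that chart.
  choose v hv using fun j => (transitionDeriv_bijective ho).2 (orthonormalFrame (m := m) φ q j)
  have hAv : ∀ j, chartDeriv (𝓡∂ (m + 1)) φ p x (v j) =
      stdOrthonormalBasis ℝ (tangentPlane (m := m) φ q) j := fun j => by
    rw [hA, ContinuousLinearMap.comp_apply, hv, differential_orthonormalFrame]
  have hon : Orthonormal ℝ fun j => chartDeriv (𝓡∂ (m + 1)) φ p x (v j) := by
    simp only [hAv]
    exact (stdOrthonormalBasis ℝ (tangentPlane (m := m) φ q)).orthonormal.comp_linearIsometry
      (tangentPlane (m := m) φ q).subtypeₗᵢ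
  have hcard : Fintype.card (Fin (Module.finrank ℝ (tangentPlane (m := m) φ q))) = m + 1 := by
    rw [Fintype.card_fin, tangentPlane, LinearMap.finrank_range_of_inj
      (hφ.injective_differential q), finrank_euclideanSpace_fin]
  rw [← sum_frame_eq_sum_gramMatrix_inv _ hcard v hon]
  have hmc := hφ.meanCurvature_eq_zero q
  simp only [meanCurvature, secondFundamentalForm] at hmc
  -- Zero mean curvature means that the traced second derivative has no normal part, so it lies in
  -- the tangent plane.
  rw [← map_sum, Submodule.starProjection_apply_eq_zero_iff,
    Submodule.orthogonal_orthogonal] at hmc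
  obtain ⟨w, hw⟩ := hmc
  -- The added sum is the tangential correction that comes from the second derivative of the change
  -- of charts.
  obtain ⟨w', hw'⟩ := (transitionDeriv_bijective ho).2 (w +
    ∑ j, fderivWithin ℝ (transitionDeriv (𝓡∂ (m + 1)) p q) (range (𝓡∂ (m + 1))) x (v j) (v j))
  refine ⟨w', ?_⟩
  rw [hA, ContinuousLinearMap.comp_apply, hw', map_add, map_sum]
  simp only [fderivWithin_chartDeriv_eq hφ.contMDiff ho, hv, Finset.sum_add_distrib]
  rw [differential_eq_chartDeriv hφ] at hw ⊢
  congr 1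
  exact hw.symm

theorem chartTransition_apply_zero {p q : M} {x : EuclideanSpace ℝ (Fin (m + 1))}
    (hx : x ∈ chartOverlap (𝓡∂ (m + 1)) p q) (hx0 : x 0 = 0) :
    chartTransition (𝓡∂ (m + 1)) p q x 0 = 0 := by
  have h1 := (mem_interior_range_chartTransition_iff hx).not.2
    (by rw [mem_interior_range_halfSpace, hx0]; exact lt_irrefl _)
  rw [mem_interior_range_halfSpace, not_lt] at h1
  exact le_antisymm h1 (mem_range_halfSpace.1 (mapsTo_chartTransition p q
    (mem_range_of_mem_chartOverlap hx)))

/-- The transition maps the half-space into itself and sends `x` to a boundary point, so coordinate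
`0` has nonnegative difference quotients along inward rays. Applying this to `w` and `-w` gives the
tangential case. -/
theorem apply_zero_transitionDeriv {p q : M} {x : EuclideanSpace ℝ (Fin (m + 1))}
    (hx : x ∈ chartOverlap (𝓡∂ (m + 1)) p q) (hx0 : x 0 = 0) :
    (∀ w : EuclideanSpace ℝ (Fin (m + 1)), 0 ≤ w 0 →
      0 ≤ transitionDeriv (𝓡∂ (m + 1)) p q x w 0) ∧
    (∀ w : EuclideanSpace ℝ (Fin (m + 1)), w 0 = 0 → transitionDeriv (𝓡∂ (m + 1)) p q x w 0 = 0) := by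
  have hτ0 := chartTransition_apply_zero hx hx0
  have key : ∀ w : EuclideanSpace ℝ (Fin (m + 1)), 0 ≤ w 0 →
      0 ≤ transitionDeriv (𝓡∂ (m + 1)) p q x w 0 := by
    intro w hw
    have h0 := (EuclideanSpace.proj 0 :
      EuclideanSpace ℝ (Fin (m + 1)) →L[ℝ] ℝ).hasFDerivAt.comp_hasFDerivWithinAt x
      (hasFDerivWithinAt_chartTransition hx)
    have hline : HasDerivWithinAt (fun t : ℝ => x + t • w) w (Ici 0) 0 := by
      simpa using (((hasDerivAt_id (0 : ℝ)).smul_const w).const_add x).hasDerivWithinAt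
    have hmaps : MapsTo (fun t : ℝ => x + t • w) (Ici 0) (range (𝓡∂ (m + 1))) := fun t ht => by
      rw [mem_range_halfSpace]
      simpa [hx0] using mul_nonneg ht hw
    have h1 := HasFDerivWithinAt.comp_hasDerivWithinAt_of_eq 0 h0 hline hmaps (by simp)
    refine ge_of_tendsto ((hasDerivWithinAt_iff_tendsto_slope' self_notMem_Ioi).1
      (h1.mono Ioi_subset_Ici_self)) ?_
    filter_upwards [self_mem_nhdsWithin] with t (ht0 : 0 < t)
    simp only [slope_def_field, Function.comp_apply, zero_smul, add_zero, sub_zero]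
    refine div_nonneg ?_ ht0.le
    have h3 := mem_range_halfSpace.1 (mapsTo_chartTransition p q (hmaps ht0.le))
    simpa [hτ0] using h3
  refine ⟨key, fun w hw => le_antisymm ?_ (key w hw.ge)⟩
  have := key (-w) (by simp [hw])
  simpa using this

/-- If the value were zero, the derivative would map all vectors into the hyperplane `u 0 = 0`,
against surjectivity. The vector `u - (u 0 / w 0) • w` is the tangential part of `u` along `w`. -/
theorem apply_zero_transitionDeriv_pos {p q : M} {x : EuclideanSpace ℝ (Fin (m + 1))}
    (hx : x ∈ chartOverlap (𝓡∂ (m + 1)) p q) (hx0 : x 0 = 0)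
    {w : EuclideanSpace ℝ (Fin (m + 1))} (hw : 0 < w 0) :
    0 < transitionDeriv (𝓡∂ (m + 1)) p q x w 0 := by
  have h := apply_zero_transitionDeriv hx hx0
  refine lt_of_le_of_ne (h.1 w hw.le) fun h0 => ?_
  obtain ⟨u, hu⟩ := (transitionDeriv_bijective hx).2 (EuclideanSpace.single 0 1)
  have h1 := h.2 (u - (u 0 / w 0) • w) (by simp; field_simp; simp)
  rw [map_sub, map_smul, hu] at h1
  simp [← h0] at h1

/-- The free boundary condition in an arbitrary preferred chart. -/
theorem chartDeriv_conormalCoord (hφ : IsFreeBoundaryMinimal m φ) {p : M}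
    {x : EuclideanSpace ℝ (Fin (m + 1))} (hx : x ∈ (extChartAt (𝓡∂ (m + 1)) p).target)
    (hx0 : x 0 = 0) :
    chartDeriv (𝓡∂ (m + 1)) φ p x (conormalCoord (chartDeriv (𝓡∂ (m + 1)) φ p x)) =
      -‖chartDeriv (𝓡∂ (m + 1)) φ p x (conormalCoord (chartDeriv (𝓡∂ (m + 1)) φ p x))‖ •
        φ ((extChartAt (𝓡∂ (m + 1)) p).symm x) := by
  set q := (extChartAt (𝓡∂ (m + 1)) p).symm x with hq
  have ho := mem_chartOverlap_self hx
  rw [← hq] at ho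
  set A := chartDeriv (𝓡∂ (m + 1)) φ p x
  have hA : A = differential φ q ∘L transitionDeriv (𝓡∂ (m + 1)) p q x :=
    chartDeriv_eq_differential_comp hφ hx
  have hAi : Function.Injective A := injective_chartDeriv hφ hx
  set c := conormalCoord A with hc
  have hc0 : 0 < c 0 := conormalCoord_zero_pos hAi
  have hnorm : 0 < ‖A c‖ := by
    have := norm_map_conormalCoord_sq hAi
    rw [norm_pos_iff]
    intro h0
    rw [← hc, h0] at this
    simp at this
    exact hc0.ne this
  have hbd : q ∈ (𝓡∂ (m + 1)).boundary M := by
    rw [ModelWithCorners.boundary, mem_ofPred_eq,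
      ModelWithCorners.isBoundaryPoint_iff_not_isInteriorPoint,
      ModelWithCorners.isInteriorPoint_iff,
      (extChartAt_target_eventuallyEq (I := 𝓡∂ (m + 1)) (x := q)).mem_interior_iff]
    have h1 := (mem_interior_range_chartTransition_iff ho).not.2
      (by rw [mem_interior_range_halfSpace, hx0]; exact lt_irrefl _)
    exact h1
  have hsphere : ‖φ q‖ = 1 := by simpa using hφ.boundary_mem_sphere q hbd
  -- `A c` points inward and is normal to the boundary, so its negative, normalized, is the outward
  -- conormal. The hypothesis at `q` then makes `A c` parallel to `φ q`.
  have hcon : IsOutwardConormal (m := m) φ q (-(‖A c‖⁻¹) • A c) := by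
    refine ⟨⟨transitionDeriv (𝓡∂ (m + 1)) p q x (-(‖A c‖⁻¹) • c), ?_, ?_⟩, ?_, ?_⟩
    · have h1 := apply_zero_transitionDeriv_pos ho hx0 (w := ‖A c‖⁻¹ • c)
        (by simpa using mul_pos (inv_pos.2 hnorm) hc0)
      simpa using h1
    · rw [← ContinuousLinearMap.comp_apply, ← hA, map_smul]
    · rw [norm_smul, norm_neg, norm_inv, norm_norm, inv_mul_cancel₀ hnorm.ne']
    · intro w hw
      obtain ⟨u, rfl⟩ := (transitionDeriv_bijective ho).2 w
      have hu : u 0 = 0 := by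
        have h1 := (apply_zero_transitionDeriv (chartTransition_mem ho)
          (chartTransition_apply_zero ho hx0)).2 _ hw
        rw [← ContinuousLinearMap.comp_apply, transitionDeriv_comp ho] at h1
        exact h1
      rw [← ContinuousLinearMap.comp_apply, ← hA, real_inner_smul_right, inner_map_conormalCoord hAi,
        hu, mul_zero]
  have hpar : ∀ w, inner ℝ (φ q) w = 0 → inner ℝ (A c) w = 0 := fun w hw => by
    have := hφ.conormal_orthogonal q hbd _ hcon w hw
    rw [real_inner_smul_left] at this
    rcases mul_eq_zero.1 this with h | h
    · simp [hnorm.ne'] at h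
    · exact h
  set s := inner ℝ (A c) (φ q) with hs
  have hAc : A c = s • φ q := by
    have h1 : inner ℝ (φ q) (A c - s • φ q) = 0 := by
      rw [inner_sub_right, real_inner_smul_right, real_inner_self_eq_norm_sq, hsphere, hs,
        real_inner_comm]
      ring
    have h2 := hpar _ h1
    rw [← sub_eq_zero, ← inner_self_eq_zero (𝕜 := ℝ), inner_sub_left, h2, real_inner_smul_left, h1]
    simp
  -- Along the inward ray `x + t c`, the function `⟨φ, φ q⟩` stays at most `1` and equals `1` at `t
  -- = 0`, so its one-sided derivative `s` is nonpositive.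
  have hs0 : s ≤ 0 := by
    have hF := hasFDerivWithinAt_chartDeriv hφ.contMDiff hx
    have hline : HasDerivWithinAt (fun t : ℝ => x + t • c) c (Ici 0) 0 := by
      simpa using (((hasDerivAt_id (0 : ℝ)).smul_const c).const_add x).hasDerivWithinAt
    have hmaps : MapsTo (fun t : ℝ => x + t • c) (Ici 0) (range (𝓡∂ (m + 1))) := fun t ht => by
      rw [mem_range_halfSpace]
      simpa [hx0] using mul_nonneg ht hc0.le
    have h1 := (HasFDerivWithinAt.comp_hasDerivWithinAt_of_eq 0 hF hline hmaps (by simp)).inner ℝ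
      (hasDerivWithinAt_const (0 : ℝ) (Ici 0) (φ q))
    have h2 := (hasDerivWithinAt_iff_tendsto_slope' self_notMem_Ioi).1 (h1.mono Ioi_subset_Ici_self)
    have h3 := le_of_tendsto h2 (b := 0) ?_
    · simpa using h3
    filter_upwards [self_mem_nhdsWithin] with t (ht0 : 0 < t)
    simp only [slope_def_field, Function.comp_apply, zero_smul, add_zero, sub_zero]
    refine div_nonpos_of_nonpos_of_nonneg ?_ ht0.le
    rw [← hq, real_inner_self_eq_norm_sq, hsphere]
    have h4 := real_inner_le_norm (φ ((extChartAt (𝓡∂ (m + 1)) p).symm (x + t • c))) (φ q)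
    have h5 : ‖φ ((extChartAt (𝓡∂ (m + 1)) p).symm (x + t • c))‖ ≤ 1 := by
      simpa using hφ.mem_closedBall ((extChartAt (𝓡∂ (m + 1)) p).symm (x + t • c))
    rw [hsphere] at h4
    linarith
  have hns : ‖A c‖ = -s := by
    rw [hAc, norm_smul, hsphere, mul_one, Real.norm_eq_abs, abs_of_nonpos hs0]
  rw [hns, neg_neg]
  exact hAc

end Geometry

/-! ### The divergence theorem in a chart -/

section ContinuityInCharts

variable {E H M W : Type*} [NormedAddCommGroup E] [NormedSpace ℝ E] [TopologicalSpace H]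
  {I : ModelWithCorners ℝ E H} [TopologicalSpace M] [ChartedSpace H M]
  [NormedAddCommGroup W] [NormedSpace ℝ W]

theorem measurableSet_extChartAt_target [MeasurableSpace E] [BorelSpace E] (p : M) :
    MeasurableSet (extChartAt I p).target := by
  rw [extChartAt_target]
  exact ((chartAt H p).open_target.preimage I.continuous_symm).measurableSet.inter
    I.isClosed_range.measurableSet

/-- The chart target is relatively open in `range I` and the complement of `K` is open. Together
they cover `range I`, and the extension by zero is continuous on each. -/
theorem continuousOn_indicator_target {W : Type*} [NormedAddCommGroup W] {p : M}
    {f : E → W} {K : Set E} (hK : IsCompact K)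
    (hf : ContinuousOn f (extChartAt I p).target) (hf0 : ∀ x ∈ (extChartAt I p).target \ K, f x = 0)
    (hKt : K ⊆ (extChartAt I p).target) :
    ContinuousOn ((extChartAt I p).target.indicator f) (range I) := by
  intro x hx
  by_cases hxt : x ∈ (extChartAt I p).target
  · have h1 := extChartAt_target_mem_nhdsWithin_of_mem hxt
    refine ((hf x hxt).mono_of_mem_nhdsWithin h1).congr_of_eventuallyEq ?_ (indicator_of_mem hxt f)
    filter_upwards [h1] with y hy using indicator_of_mem hy f
  · have h0 : ∀ y ∉ K, (extChartAt I p).target.indicator f y = 0 := fun y hy => by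
      by_cases hyt : y ∈ (extChartAt I p).target
      · rw [indicator_of_mem hyt, hf0 y ⟨hyt, hy⟩]
      · exact indicator_of_notMem hyt f
    have hxK : x ∉ K := fun h => hxt (hKt h)
    refine (continuousWithinAt_const (b := (0 : W))).congr_of_eventuallyEq ?_ (h0 x hxK)
    filter_upwards [mem_nhdsWithin_of_mem_nhds (hK.isClosed.isOpen_compl.mem_nhds hxK)] with y hy
      using h0 y hy

theorem integrableOn_indicator_target [MeasurableSpace E] [BorelSpace E] {μ : Measure E}
    [IsFiniteMeasureOnCompacts μ] {p : M} {f : E → ℝ} {K : Set E} (hK : IsCompact K)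
    (hf : ContinuousOn f (extChartAt I p).target) (hf0 : ∀ x ∈ (extChartAt I p).target \ K, f x = 0)
    (hKt : K ⊆ (extChartAt I p).target) :
    IntegrableOn ((extChartAt I p).target.indicator f) (range I) μ := by
  have h := ((continuousOn_indicator_target hK hf hf0 hKt).mono
    (hKt.trans (extChartAt_target_subset_range p))).integrableOn_compact (μ := μ) hK
  refine h.of_forall_sdiff_eq_zero I.isClosed_range.measurableSet fun x hx => ?_
  by_cases hxt : x ∈ (extChartAt I p).target
  · rw [indicator_of_mem hxt, hf0 x ⟨hxt, hx.2⟩]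
  · exact indicator_of_notMem hxt f

theorem integrableOn_target_inter_interior [MeasurableSpace E] [BorelSpace E] {μ : Measure E}
    [IsFiniteMeasureOnCompacts μ] {p : M} {f : E → ℝ} {K : Set E} (hK : IsCompact K)
    (hf : ContinuousOn f (extChartAt I p).target) (hf0 : ∀ x ∈ (extChartAt I p).target \ K, f x = 0)
    (hKt : K ⊆ (extChartAt I p).target) :
    IntegrableOn f ((extChartAt I p).target ∩ interior (range I)) μ := by
  refine ((integrableOn_indicator_target hK hf hf0 hKt).mono_set
    (inter_subset_right.trans interior_subset)).congr_fun (fun x hx => indicator_of_mem hx.1 f)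
    ((measurableSet_extChartAt_target p).inter isOpen_interior.measurableSet)

theorem isCompact_extChartAt_image_tsupport [CompactSpace M] {p : M} {ρ : M → ℝ}
    (hρ : tsupport ρ ⊆ (chartAt H p).source) : IsCompact (extChartAt I p '' tsupport ρ) :=
  (isClosed_tsupport ρ).isCompact.image_of_continuousOn
    ((continuousOn_extChartAt p).mono (by rwa [extChartAt_source]))

theorem extChartAt_image_tsupport_subset {p : M} {ρ : M → ℝ}
    (hρ : tsupport ρ ⊆ (chartAt H p).source) :
    extChartAt I p '' tsupport ρ ⊆ (extChartAt I p).target := by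
  rintro _ ⟨q, hq, rfl⟩
  exact (extChartAt I p).map_source (by rw [extChartAt_source]; exact hρ hq)

theorem extChartAt_symm_notMem_tsupport {p : M} {ρ : M → ℝ} {x : E}
    (hx : x ∈ (extChartAt I p).target \ extChartAt I p '' tsupport ρ) :
    (extChartAt I p).symm x ∉ tsupport ρ :=
  fun h => hx.2 ⟨_, h, (extChartAt I p).right_inv hx.1⟩

theorem chartDeriv_eq_zero_of_notMem_tsupport {f : M → W} {p : M} {x : E}
    (hx : x ∈ (extChartAt I p).target) (hf : (extChartAt I p).symm x ∉ tsupport f) :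
    chartDeriv I f p x = 0 := by
  have h1 := (continuousAt_extChartAt_symm'' hx).eventually (notMem_tsupport_iff_eventuallyEq.1 hf)
  have h2 : f ∘ (extChartAt I p).symm =ᶠ[𝓝[range I] x] fun _ => 0 :=
    Filter.Eventually.filter_mono nhdsWithin_le_nhds h1
  rw [chartDeriv, h2.fderivWithin_eq (h2.self_of_nhdsWithin (extChartAt_target_subset_range p hx)),
    fderivWithin_fun_const]
  rfl

end ContinuityInCharts

/-! ### The flux of a coordinate function and Green's formula. -/

section Flux

variable {m n : ℕ} {M : Type*} [TopologicalSpace M] [ChartedSpace (EuclideanHalfSpace (m + 1)) M]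
  {φ : M → EuclideanSpace ℝ (Fin n)}

/-- The gradient of `⟨φ, e⟩` times the Riemannian density, in the preferred chart at `p`. -/
def gradientFlux (φ : M → EuclideanSpace ℝ (Fin n)) (e : EuclideanSpace ℝ (Fin n)) (p : M)
    (x : EuclideanSpace ℝ (Fin (m + 1))) : EuclideanSpace ℝ (Fin (m + 1)) :=
  volumeDensity (chartDeriv (𝓡∂ (m + 1)) φ p x) •
    tangentialCoord (chartDeriv (𝓡∂ (m + 1)) φ p x) e

theorem hasFDerivAt_face (y : EuclideanSpace ℝ (Fin m)) : ∃ L : EuclideanSpace ℝ (Fin m) →L[ℝ]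
    EuclideanSpace ℝ (Fin (m + 1)), HasFDerivAt face L y ∧ ∀ v, L v = face v := by
  let L : EuclideanSpace ℝ (Fin m) →ₗ[ℝ] EuclideanSpace ℝ (Fin (m + 1)) :=
    { toFun := face
      map_add' := fun u v => by
        ext i
        refine Fin.cases ?_ (fun i => ?_) i <;> simp [face]
      map_smul' := fun c v => by
        ext i
        refine Fin.cases ?_ (fun i => ?_) i <;> simp [face] }
  exact ⟨L.toContinuousLinearMap, L.toContinuousLinearMap.hasFDerivAt, fun v => rfl⟩

theorem continuous_face : Continuous (face : EuclideanSpace ℝ (Fin m) → _) :=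
  continuous_iff_continuousAt.2 fun y => (hasFDerivAt_face y).choose_spec.1.continuousAt

theorem face_zero (y : EuclideanSpace ℝ (Fin m)) : face y 0 = 0 := rfl

theorem face_single (a : Fin m) :
    face (EuclideanSpace.single a 1) = EuclideanSpace.single a.succ 1 := by
  ext i
  refine Fin.cases ?_ (fun i => ?_) i
  · simp [face]
  · simp [face]

theorem face_mem_range (y : EuclideanSpace ℝ (Fin m)) : face y ∈ range (𝓡∂ (m + 1)) :=
  mem_range_halfSpace.2 (face_zero y).ge

theorem isOpen_boundaryDomain (p : M) : IsOpen (boundaryDomain (m := m) p) := by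
  have : boundaryDomain (m := m) p = face ⁻¹' ((𝓡∂ (m + 1)).symm ⁻¹'
      (chartAt (EuclideanHalfSpace (m + 1)) p).target) := by
    ext y
    simp only [boundaryDomain, mem_preimage, extChartAt_target, mem_inter_iff, face_mem_range,
      and_true]
  rw [this]
  exact ((chartAt (EuclideanHalfSpace (m + 1)) p).open_target.preimage
    (𝓡∂ (m + 1)).continuous_symm).preimage continuous_face

theorem continuousOn_boundaryParam (p : M) :
    ContinuousOn (boundaryParam (m := m) p) (boundaryDomain p) :=
  (continuousOn_extChartAt_symm p).comp continuous_face.continuousOn fun _ hy => hy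

variable [IsManifold (𝓡∂ (m + 1)) ∞ M]

/-- `face` is linear with values in the half-space, so the chain rule turns the one-sided derivative
of `φ` into a full derivative along the boundary. -/
theorem boundaryMetric_eq_submatrix (hφ : IsFreeBoundaryMinimal m φ) {p : M}
    {y : EuclideanSpace ℝ (Fin m)} (hy : y ∈ boundaryDomain p) :
    boundaryMetric φ p y =
      (gramMatrix (chartDeriv (𝓡∂ (m + 1)) φ p (face y))).submatrix Fin.succ Fin.succ := by
  obtain ⟨L, hL, hLv⟩ := hasFDerivAt_face y
  have h := (hasFDerivWithinAt_chartDeriv hφ.contMDiff (p := p) (x := face y) hy).comp_hasFDerivAt y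
    hL (.of_forall fun z => face_mem_range z)
  have h2 : fderiv ℝ (fun z => φ (boundaryParam p z)) y =
      chartDeriv (𝓡∂ (m + 1)) φ p (face y) ∘L L := h.fderiv
  ext a b
  simp only [boundaryMetric, Matrix.of_apply, h2, ContinuousLinearMap.comp_apply, hLv, face_single,
    Matrix.submatrix_apply, gramMatrix_apply]

theorem continuousOn_gradientFlux (hφ : IsFreeBoundaryMinimal m φ)
    (e : EuclideanSpace ℝ (Fin n)) (p : M) :
    ContinuousOn (gradientFlux φ e p) (extChartAt (𝓡∂ (m + 1)) p).target := by
  intro x hx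
  have h := continuousOn_chartDeriv hφ.contMDiff p x hx
  have hA := injective_chartDeriv hφ hx
  exact ContinuousWithinAt.smul (continuous_volumeDensity.continuousAt.comp_continuousWithinAt h)
    ((contDiffAt_tangentialCoord hA e).continuousAt.comp_continuousWithinAt h)

/-- The flux through the boundary. -/
theorem gradientFlux_face_zero (hφ : IsFreeBoundaryMinimal m φ) (e : EuclideanSpace ℝ (Fin n))
    {p : M} {y : EuclideanSpace ℝ (Fin m)} (hy : y ∈ boundaryDomain p) :
    gradientFlux φ e p (face y) 0 =
      -(√(boundaryMetric φ p y).det * inner ℝ (φ (boundaryParam p y)) e) := by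
  have hA := injective_chartDeriv hφ (p := p) (x := face y) hy
  -- The component is `√(det G) ⟨A c, e⟩` with `A c = -‖A c‖ φ`, and `√(det G) ‖A c‖` is the
  -- boundary density.
  rw [gradientFlux, PiLp.smul_apply, smul_eq_mul, tangentialCoord_zero_eq_inner hA,
    chartDeriv_conormalCoord hφ hy (face_zero y), real_inner_smul_left, neg_mul, mul_neg,
    ← mul_assoc, volumeDensity_mul_norm_conormal hA, boundaryMetric_eq_submatrix hφ hy]
  rfl

/-- Near an interior point the derivative within the half-space is the ordinary one, so minimality
in the chart feeds the Euclidean computation. -/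
theorem sum_fderiv_gradientFlux (hφ : IsFreeBoundaryMinimal m φ) (e : EuclideanSpace ℝ (Fin n))
    {p : M} {x : EuclideanSpace ℝ (Fin (m + 1))} (hx : x ∈ (extChartAt (𝓡∂ (m + 1)) p).target)
    (hxi : x ∈ interior (range (𝓡∂ (m + 1)))) :
    DifferentiableAt ℝ (gradientFlux φ e p) x ∧
      ∑ a, fderiv ℝ (gradientFlux φ e p) x (EuclideanSpace.single a 1) a = 0 := by
  have hn : range (𝓡∂ (m + 1)) ∈ 𝓝 x := mem_interior_iff_mem_nhds.1 hxi
  have h1 : chartDeriv (𝓡∂ (m + 1)) φ p =ᶠ[𝓝 x]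
      fderiv ℝ (φ ∘ (extChartAt (𝓡∂ (m + 1)) p).symm) := by
    filter_upwards [isOpen_interior.mem_nhds hxi] with y hy
    exact fderivWithin_of_mem_nhds (mem_interior_iff_mem_nhds.1 hy)
  have h2 : gradientFlux φ e p =ᶠ[𝓝 x] fun y =>
      volumeDensity (fderiv ℝ (φ ∘ (extChartAt (𝓡∂ (m + 1)) p).symm) y) •
        tangentialCoord (fderiv ℝ (φ ∘ (extChartAt (𝓡∂ (m + 1)) p).symm) y) e := by
    filter_upwards [h1] with y hy
    rw [gradientFlux, hy]
  rw [h2.differentiableAt_iff, h2.fderiv_eq]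
  refine sum_fderiv_volumeDensity_smul_tangentialCoord ?_ ?_ e ?_
  · exact contDiffAt_infty.1
      ((contDiffWithinAt_comp_extChartAt_symm hφ.contMDiff hx).contDiffAt hn) 2
  · rw [← h1.eq_of_nhds]
    exact injective_chartDeriv hφ hx
  · have h3 := exists_trace_eq_chartDeriv hφ hx
    rw [fderivWithin_of_mem_nhds hn, h1.fderiv_eq, h1.eq_of_nhds] at h3
    exact h3

theorem continuousOn_chartDeriv_gradientFlux (hφ : IsFreeBoundaryMinimal m φ)
    (e : EuclideanSpace ℝ (Fin n)) {ρ : M → ℝ} (hρ : ContMDiff (𝓡∂ (m + 1)) 𝓘(ℝ, ℝ) ∞ ρ) (p : M) :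
    ContinuousOn (fun x => chartDeriv (𝓡∂ (m + 1)) ρ p x (gradientFlux φ e p x))
      (extChartAt (𝓡∂ (m + 1)) p).target :=
  (continuousOn_chartDeriv hρ p).clm_apply (continuousOn_gradientFlux hφ e p)

/-- Green's formula in a chart. -/
theorem setIntegral_chartDeriv_gradientFlux [CompactSpace M] (hφ : IsFreeBoundaryMinimal m φ)
    (e : EuclideanSpace ℝ (Fin n)) {ρ : M → ℝ} (hρ : ContMDiff (𝓡∂ (m + 1)) 𝓘(ℝ, ℝ) ∞ ρ) {p : M}
    (hs : tsupport ρ ⊆ (chartAt (EuclideanHalfSpace (m + 1)) p).source) :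
    ∫ x in (extChartAt (𝓡∂ (m + 1)) p).target ∩ interior (range (𝓡∂ (m + 1))),
      chartDeriv (𝓡∂ (m + 1)) ρ p x (gradientFlux φ e p x) =
    ∫ y in boundaryDomain (m := m) p, ρ (boundaryParam p y) * √(boundaryMetric φ p y).det *
      inner ℝ (φ (boundaryParam p y)) e := by
  set T := (extChartAt (𝓡∂ (m + 1)) p).target
  set K := extChartAt (𝓡∂ (m + 1)) p '' tsupport ρ
  have hK : IsCompact K := isCompact_extChartAt_image_tsupport hs
  have hKT : K ⊆ T := extChartAt_image_tsupport_subset hs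
  -- The divergence theorem is applied to `ρ` times the flux, extended by zero. The flux is
  -- divergence free, so only `dρ(flux)` survives. The sign of the inward face cancels the sign in
  -- `gradientFlux_face_zero`.
  let f : EuclideanSpace ℝ (Fin (m + 1)) → EuclideanSpace ℝ (Fin (m + 1)) :=
    fun x => (ρ ∘ (extChartAt (𝓡∂ (m + 1)) p).symm) x • gradientFlux φ e p x
  have hf0 : ∀ x ∈ T \ K, f x = 0 := fun x hx => by
    simp only [f, Function.comp_apply,
      image_eq_zero_of_notMem_tsupport (extChartAt_symm_notMem_tsupport hx), zero_smul]
  have hf : ContinuousOn f T := fun x hx =>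
    (((contDiffWithinAt_comp_extChartAt_symm hρ hx).continuousWithinAt.mono
      (extChartAt_target_subset_range p))).smul (continuousOn_gradientFlux hφ e p x hx)
  have hX0 : ∀ x ∉ K, T.indicator f x = 0 := fun x hx => by
    by_cases hxt : x ∈ T
    · rw [indicator_of_mem hxt, hf0 x ⟨hxt, hx⟩]
    · exact indicator_of_notMem hxt f
  have hpos : {x : EuclideanSpace ℝ (Fin (m + 1)) | 0 < x 0} = interior (range (𝓡∂ (m + 1))) :=
    ext fun x => mem_interior_range_halfSpace.symm
  have hnonneg : {x : EuclideanSpace ℝ (Fin (m + 1)) | 0 ≤ x 0} = range (𝓡∂ (m + 1)) :=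
    ext fun x => mem_range_halfSpace.symm
  have hder : ∀ x ∈ interior (range (𝓡∂ (m + 1))), DifferentiableAt ℝ (T.indicator f) x ∧
      ∑ a, fderiv ℝ (T.indicator f) x (EuclideanSpace.single a 1) a =
        T.indicator (fun x => chartDeriv (𝓡∂ (m + 1)) ρ p x (gradientFlux φ e p x)) x := by
    intro x hx
    have hn : range (𝓡∂ (m + 1)) ∈ 𝓝 x := mem_interior_iff_mem_nhds.1 hx
    by_cases hxt : x ∈ T
    · have h1 : T.indicator f =ᶠ[𝓝 x] f := by
        have := extChartAt_target_mem_nhdsWithin_of_mem hxt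
        rw [nhdsWithin_eq_nhds.2 hn] at this
        filter_upwards [this] with y hy using indicator_of_mem hy f
      obtain ⟨hd, hdiv⟩ := sum_fderiv_gradientFlux hφ e hxt hx
      have hρd := (hasFDerivWithinAt_chartDeriv hρ hxt).hasFDerivAt hn
      rw [h1.differentiableAt_iff, h1.fderiv_eq, indicator_of_mem hxt]
      refine ⟨hρd.differentiableAt.smul hd, ?_⟩
      have hfd : HasFDerivAt f _ x := hρd.smul hd.hasFDerivAt
      rw [hfd.fderiv, map_eq_sum (chartDeriv (𝓡∂ (m + 1)) ρ p x)]
      simp only [add_apply, smul_apply, ContinuousLinearMap.smulRight_apply, PiLp.add_apply,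
        PiLp.smul_apply, smul_eq_mul, Finset.sum_add_distrib]
      rw [← Finset.mul_sum, hdiv, mul_zero, zero_add]
      exact Finset.sum_congr rfl fun a _ => mul_comm _ _
    · have hxK : x ∉ K := fun h => hxt (hKT h)
      have h1 : T.indicator f =ᶠ[𝓝 x] fun _ => 0 := by
        filter_upwards [hK.isClosed.isOpen_compl.mem_nhds hxK] with y hy using hX0 y hy
      rw [h1.differentiableAt_iff, h1.fderiv_eq, indicator_of_notMem hxt]
      simp
  have hdens0 : ∀ x ∈ T \ K, chartDeriv (𝓡∂ (m + 1)) ρ p x (gradientFlux φ e p x) = 0 :=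
    fun x hx => by
      rw [chartDeriv_eq_zero_of_notMem_tsupport hx.1 (extChartAt_symm_notMem_tsupport hx)]
      rfl
  have hint := (integrableOn_indicator_target (μ := volume) hK
    (continuousOn_chartDeriv_gradientFlux hφ e hρ p) hdens0 hKT).mono_set interior_subset
  have key := integral_divergence_halfSpace hK hX0
    (hnonneg ▸ continuousOn_indicator_target hK hf hf0 hKT)
    (fun x hx => (hder x (hpos ▸ hx)).1)
    (hpos ▸ hint.congr_fun (fun x hx => (hder x hx).2.symm) isOpen_interior.measurableSet)
  rw [hpos, setIntegral_congr_fun isOpen_interior.measurableSet fun x hx => (hder x hx).2,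
    setIntegral_indicator (measurableSet_extChartAt_target p), inter_comm] at key
  rw [key, ← integral_neg, ← integral_indicator (isOpen_boundaryDomain p).measurableSet]
  congr 1
  ext y
  by_cases hy : y ∈ boundaryDomain p
  · rw [indicator_of_mem hy, indicator_of_mem (show face y ∈ T from hy), PiLp.smul_apply,
      gradientFlux_face_zero hφ e hy, smul_eq_mul, mul_neg, neg_neg, ← mul_assoc]
    rfl
  · rw [indicator_of_notMem hy, indicator_of_notMem (show face y ∉ T from hy)]
    simp

end Flux

/-! ### Gluing the charts -/

section Global

variable {m n : ℕ} {M : Type*} [TopologicalSpace M] [ChartedSpace (EuclideanHalfSpace (m + 1)) M]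
  [IsManifold (𝓡∂ (m + 1)) ∞ M] {φ : M → EuclideanSpace ℝ (Fin n)}

/-- `⟨grad ρ, grad ⟨φ, e⟩⟩ √(det G)` is a density: the Jacobian factor comes from the volume, while
the pairing of a covector with a vector is invariant. -/
theorem chartDeriv_gradientFlux_eq (hφ : IsFreeBoundaryMinimal m φ) (e : EuclideanSpace ℝ (Fin n))
    {ρ : M → ℝ} (hρ : ContMDiff (𝓡∂ (m + 1)) 𝓘(ℝ, ℝ) ∞ ρ) {p q : M}
    {x : EuclideanSpace ℝ (Fin (m + 1))} (hx : x ∈ chartOverlap (𝓡∂ (m + 1)) p q) :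
    chartDeriv (𝓡∂ (m + 1)) ρ p x (gradientFlux φ e p x) =
      |(transitionDeriv (𝓡∂ (m + 1)) p q x).det| *
        chartDeriv (𝓡∂ (m + 1)) ρ q (chartTransition (𝓡∂ (m + 1)) p q x)
          (gradientFlux φ e q (chartTransition (𝓡∂ (m + 1)) p q x)) := by
  have hA := injective_chartDeriv hφ (chartTransition_mem hx).1
  rw [gradientFlux, chartDeriv_eq_comp hρ hx, chartDeriv_eq_comp hφ.contMDiff hx,
    volumeDensity_comp, ContinuousLinearMap.comp_apply, map_smul,
    map_tangentialCoord_comp hA _ (transitionDeriv_bijective hx), gradientFlux, map_smul, map_smul,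
    smul_eq_mul, smul_eq_mul, mul_assoc]

/-- An integral over the intersection of two chart domains may be computed in either chart. -/
theorem setIntegral_mul_chartDeriv_gradientFlux_comm (hφ : IsFreeBoundaryMinimal m φ)
    (e : EuclideanSpace ℝ (Fin n)) {ρ σ : M → ℝ} (hρ : ContMDiff (𝓡∂ (m + 1)) 𝓘(ℝ, ℝ) ∞ ρ)
    {p q : M} (hsρ : tsupport ρ ⊆ (chartAt (EuclideanHalfSpace (m + 1)) p).source)
    (hsσ : tsupport σ ⊆ (chartAt (EuclideanHalfSpace (m + 1)) q).source) :
    ∫ x in (extChartAt (𝓡∂ (m + 1)) p).target ∩ interior (range (𝓡∂ (m + 1))),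
      σ ((extChartAt (𝓡∂ (m + 1)) p).symm x) *
        chartDeriv (𝓡∂ (m + 1)) ρ p x (gradientFlux φ e p x) =
    ∫ x in (extChartAt (𝓡∂ (m + 1)) q).target ∩ interior (range (𝓡∂ (m + 1))),
      σ ((extChartAt (𝓡∂ (m + 1)) q).symm x) *
        chartDeriv (𝓡∂ (m + 1)) ρ q x (gradientFlux φ e q x) := by
  have hmeas : ∀ r : M, MeasurableSet
      ((extChartAt (𝓡∂ (m + 1)) r).target ∩ interior (range (𝓡∂ (m + 1)))) := fun r =>
    (measurableSet_extChartAt_target r).inter isOpen_interior.measurableSet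
  have hsub : ∀ r r' : M, chartOverlap (𝓡∂ (m + 1)) r r' ∩ interior (range (𝓡∂ (m + 1))) ⊆
      (extChartAt (𝓡∂ (m + 1)) r).target ∩ interior (range (𝓡∂ (m + 1))) := fun r r' =>
    inter_subset_inter_left _ inter_subset_left
  -- Both integrals live on the overlap: in the chart at `p` because `σ` vanishes off the domain at
  -- `q`, and in the chart at `q` because `dρ` vanishes off the domain at `p`.
  rw [setIntegral_eq_of_subset_of_forall_sdiff_eq_zero (hmeas p) (hsub p q),
    setIntegral_eq_of_subset_of_forall_sdiff_eq_zero (hmeas q) (hsub q p),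
    setIntegral_chartOverlap_eq volume p q]
  · refine setIntegral_congr_fun ?_ fun x hx => ?_
    · exact (isOpen_chartOverlap_inter_interior p q).measurableSet
    · simp only [chartDeriv_gradientFlux_eq hφ e hρ hx.1, extChartAt_symm_chartTransition hx.1]
      ring
  · intro x hx
    have h1 : (extChartAt (𝓡∂ (m + 1)) q).symm x ∉ tsupport ρ := fun h =>
      hx.2 ⟨⟨hx.1.1, by rw [mem_preimage, extChartAt_source]; exact hsρ h⟩, hx.1.2⟩
    rw [chartDeriv_eq_zero_of_notMem_tsupport hx.1.1 h1]
    simp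
  · intro x hx
    have h1 : (extChartAt (𝓡∂ (m + 1)) p).symm x ∉ tsupport σ := fun h =>
      hx.2 ⟨⟨hx.1.1, by rw [mem_preimage, extChartAt_source]; exact hsσ h⟩, hx.1.2⟩
    rw [image_eq_zero_of_notMem_tsupport h1, zero_mul]

theorem integrableOn_mul_chartDeriv_gradientFlux [CompactSpace M] (hφ : IsFreeBoundaryMinimal m φ)
    (e : EuclideanSpace ℝ (Fin n)) {ρ σ : M → ℝ} (hρ : ContMDiff (𝓡∂ (m + 1)) 𝓘(ℝ, ℝ) ∞ ρ)
    (hσ : ContMDiff (𝓡∂ (m + 1)) 𝓘(ℝ, ℝ) ∞ σ) {p : M}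
    (hs : tsupport ρ ⊆ (chartAt (EuclideanHalfSpace (m + 1)) p).source ∨
      tsupport σ ⊆ (chartAt (EuclideanHalfSpace (m + 1)) p).source) :
    IntegrableOn (fun x => σ ((extChartAt (𝓡∂ (m + 1)) p).symm x) *
        chartDeriv (𝓡∂ (m + 1)) ρ p x (gradientFlux φ e p x))
      ((extChartAt (𝓡∂ (m + 1)) p).target ∩ interior (range (𝓡∂ (m + 1)))) := by
  have hc := (hσ.continuous.comp_continuousOn
    (continuousOn_extChartAt_symm (I := 𝓡∂ (m + 1)) p)).mul
      (continuousOn_chartDeriv_gradientFlux hφ e hρ p)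
  rcases hs with hs | hs
  · refine integrableOn_target_inter_interior (isCompact_extChartAt_image_tsupport hs) hc
      (fun x hx => ?_) (extChartAt_image_tsupport_subset hs)
    rw [chartDeriv_eq_zero_of_notMem_tsupport hx.1 (extChartAt_symm_notMem_tsupport hx)]
    simp
  · refine integrableOn_target_inter_interior (isCompact_extChartAt_image_tsupport hs) hc
      (fun x hx => ?_) (extChartAt_image_tsupport_subset hs)
    rw [image_eq_zero_of_notMem_tsupport (extChartAt_symm_notMem_tsupport hx), zero_mul]

theorem sum_chartDeriv_eq_zero {ι : Type*} {s : Finset ι} {ρ : ι → M → ℝ}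
    (hρ : ∀ p, ContMDiff (𝓡∂ (m + 1)) 𝓘(ℝ, ℝ) ∞ (ρ p)) (hsum : ∀ x, ∑ p ∈ s, ρ p x = 1) {q : M}
    {x : EuclideanSpace ℝ (Fin (m + 1))} (hx : x ∈ (extChartAt (𝓡∂ (m + 1)) q).target) :
    ∑ p ∈ s, chartDeriv (𝓡∂ (m + 1)) (ρ p) q x = 0 := by
  have h := HasFDerivWithinAt.fun_sum fun p (_ : p ∈ s) => hasFDerivWithinAt_chartDeriv (hρ p) hx
  simp only [Function.comp_apply, hsum] at h
  exact ((𝓡∂ (m + 1)).uniqueDiffOn x (extChartAt_target_subset_range q hx)).eq h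
    (hasFDerivWithinAt_const _ _ _)

/-- The chart integrals of `⟨grad ρ_p, grad ⟨φ, e⟩⟩` cancel for a partition of unity `ρ`. -/
theorem sum_setIntegral_chartDeriv_gradientFlux [CompactSpace M] (hφ : IsFreeBoundaryMinimal m φ)
    (e : EuclideanSpace ℝ (Fin n)) {s : Finset M} {ρ : M → M → ℝ}
    (hρ : ∀ p, ContMDiff (𝓡∂ (m + 1)) 𝓘(ℝ, ℝ) ∞ (ρ p)) (hsum : ∀ x, ∑ p ∈ s, ρ p x = 1)
    (hs : ∀ p, tsupport (ρ p) ⊆ (chartAt (EuclideanHalfSpace (m + 1)) p).source) :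
    ∑ p ∈ s, ∫ x in (extChartAt (𝓡∂ (m + 1)) p).target ∩ interior (range (𝓡∂ (m + 1))),
      chartDeriv (𝓡∂ (m + 1)) (ρ p) p x (gradientFlux φ e p x) = 0 := by
  -- Insert `1 = ∑ ρ_q` in the chart at `p` and move each summand to the chart at `q`.
  have h1 : ∀ p, ∫ x in (extChartAt (𝓡∂ (m + 1)) p).target ∩ interior (range (𝓡∂ (m + 1))),
      chartDeriv (𝓡∂ (m + 1)) (ρ p) p x (gradientFlux φ e p x) =
      ∑ q ∈ s, ∫ x in (extChartAt (𝓡∂ (m + 1)) q).target ∩ interior (range (𝓡∂ (m + 1))),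
        ρ q ((extChartAt (𝓡∂ (m + 1)) q).symm x) *
          chartDeriv (𝓡∂ (m + 1)) (ρ p) q x (gradientFlux φ e q x) := fun p => by
    simp only [← setIntegral_mul_chartDeriv_gradientFlux_comm hφ e (hρ p) (hs p) (hs _)]
    rw [← integral_finsetSum _ fun q _ =>
      integrableOn_mul_chartDeriv_gradientFlux hφ e (hρ p) (hρ q) (Or.inl (hs p))]
    simp only [← Finset.sum_mul, hsum, one_mul]
  simp only [h1]
  -- With `q` fixed, all terms are now in one chart, where `∑ dρ_p = 0`.
  rw [Finset.sum_comm]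
  refine Finset.sum_eq_zero fun q _ => ?_
  rw [← integral_finsetSum _ fun p _ =>
    integrableOn_mul_chartDeriv_gradientFlux hφ e (hρ p) (hρ q) (Or.inr (hs q))]
  refine setIntegral_eq_zero_of_forall_eq_zero fun x hx => ?_
  rw [← Finset.mul_sum, ← sum_apply, sum_chartDeriv_eq_zero hρ hsum hx.1]
  simp

end Global

/-! ### The boundary measure as a finite sum of chart integrals. -/

section Measure

variable {m n : ℕ} {M : Type*} [TopologicalSpace M] [T2Space M] [CompactSpace M]
  [ChartedSpace (EuclideanHalfSpace (m + 1)) M] [IsManifold (𝓡∂ (m + 1)) ∞ M]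

theorem tsupport_chartPartition_subset (p : M) :
    tsupport (chartPartition m M p) ⊆ (chartAt (EuclideanHalfSpace (m + 1)) p).source :=
  (SmoothPartitionOfUnity.exists_isSubordinate_chartAt_source (𝓡∂ (m + 1)) M).choose_spec p

variable (m M) in
theorem exists_finset_chartPartition : ∃ s : Finset M,
    (∀ p ∉ s, ∀ x, chartPartition m M p x = 0) ∧ ∀ x, ∑ p ∈ s, chartPartition m M p x = 1 := by
  have hfin := (chartPartition m M).locallyFinite.finite_nonempty_of_compact
  have h0 : ∀ p ∉ hfin.toFinset, ∀ x, chartPartition m M p x = 0 := fun p hp x => by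
    by_contra hx
    exact hp (hfin.mem_toFinset.2 ⟨x, hx⟩)
  refine ⟨hfin.toFinset, h0, fun x => ?_⟩
  rw [← (chartPartition m M).sum_eq_one (mem_univ x), eq_comm]
  refine finsum_eq_sum_of_support_subset _ fun p hp => ?_
  by_contra hp'
  exact hp (h0 p hp' x)

variable {φ : M → EuclideanSpace ℝ (Fin n)}

theorem continuousOn_boundaryDensity (hφ : IsFreeBoundaryMinimal m φ) (p : M) :
    ContinuousOn (fun y => chartPartition m M p (boundaryParam p y) * √(boundaryMetric φ p y).det)
      (boundaryDomain (m := m) p) := by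
  have h1 : ContinuousOn (fun y => chartDeriv (𝓡∂ (m + 1)) φ p (face y)) (boundaryDomain p) :=
    (continuousOn_chartDeriv hφ.contMDiff p).comp continuous_face.continuousOn fun _ hy => hy
  refine ((chartPartition m M p).contMDiff.continuous.comp_continuousOn
    (continuousOn_boundaryParam p)).mul (Real.continuous_sqrt.comp_continuousOn ?_)
  refine ContinuousOn.congr ?_ fun y hy => congrArg Matrix.det (boundaryMetric_eq_submatrix hφ hy)
  have h2 : Continuous fun A : EuclideanSpace ℝ (Fin (m + 1)) →L[ℝ] EuclideanSpace ℝ (Fin n) =>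
      ((gramMatrix A).submatrix Fin.succ Fin.succ).det :=
    (contDiff_iff_contDiffAt.2 fun A => contDiffAt_matrix_det fun a b =>
      (contDiff_gramMatrix a.succ b.succ).contDiffAt).continuous
  exact h2.comp_continuousOn h1

theorem boundaryDensity_nonneg (φ : M → EuclideanSpace ℝ (Fin n)) (p : M)
    (y : EuclideanSpace ℝ (Fin m)) :
    0 ≤ chartPartition m M p (boundaryParam p y) * √(boundaryMetric φ p y).det :=
  mul_nonneg ((chartPartition m M).nonneg p _) (Real.sqrt_nonneg _)

variable [MeasurableSpace M]

/-- The contribution of the chart at `p` to the boundary measure. -/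
def chartBoundaryMeasure (φ : M → EuclideanSpace ℝ (Fin n)) (p : M) : Measure M :=
  Measure.map (boundaryParam p)
    ((volume.restrict (boundaryDomain (m := m) p)).withDensity fun y =>
      ENNReal.ofReal (chartPartition m M p (boundaryParam p y) * √(boundaryMetric φ p y).det))

theorem boundaryMeasure_eq_sum (φ : M → EuclideanSpace ℝ (Fin n)) {s : Finset M}
    (hs : ∀ p ∉ s, ∀ x, chartPartition m M p x = 0) :
    boundaryMeasure m φ = ∑ p ∈ s, chartBoundaryMeasure (m := m) φ p := by
  ext t ht
  rw [boundaryMeasure, Measure.sum_apply _ ht, Measure.finsetSum_apply, tsum_eq_sum]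
  · rfl
  · intro p hp
    simp [hs p hp]

variable [BorelSpace M]

/-- The density is continuous on the boundary part of the chart, and `ρ_p` is supported on a compact
subset of the chart, whence integrability. -/
theorem integrable_chartBoundaryMeasure (hφ : IsFreeBoundaryMinimal m φ) {f : M → ℝ}
    (hf : Continuous f) (p : M) : Integrable f (chartBoundaryMeasure (m := m) φ p) ∧
      ∫ x, f x ∂chartBoundaryMeasure (m := m) φ p =
        ∫ y in boundaryDomain (m := m) p, chartPartition m M p (boundaryParam p y) *
          √(boundaryMetric φ p y).det * f (boundaryParam p y) := by
  have hD := (isOpen_boundaryDomain (m := m) p).measurableSet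
  have hg := continuousOn_boundaryDensity hφ p
  have hd := (hg.aemeasurable (μ := volume) hD).ennreal_ofReal
  have hparam : AEMeasurable (boundaryParam p)
      ((volume.restrict (boundaryDomain (m := m) p)).withDensity fun y =>
        ENNReal.ofReal (chartPartition m M p (boundaryParam p y) *
          √(boundaryMetric φ p y).det)) :=
    ((continuousOn_boundaryParam p).aemeasurable hD).mono_ac (withDensity_absolutelyContinuous _ _)
  have hint : IntegrableOn (fun y => chartPartition m M p (boundaryParam p y) *
      √(boundaryMetric φ p y).det * f (boundaryParam p y)) (boundaryDomain (m := m) p) := by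
    have hc := hg.mul (hf.comp_continuousOn (continuousOn_boundaryParam p))
    have hK := isCompact_extChartAt_image_tsupport (I := 𝓡∂ (m + 1))
      (tsupport_chartPartition_subset (m := m) p)
    have hKt := extChartAt_image_tsupport_subset (I := 𝓡∂ (m + 1))
      (tsupport_chartPartition_subset (m := m) p)
    set K := extChartAt (𝓡∂ (m + 1)) p '' tsupport (chartPartition m M p)
    -- `face` preserves norms, so the preimage of a compact set is closed and bounded.
    have hK' : IsCompact (face ⁻¹' K : Set (EuclideanSpace ℝ (Fin m))) := by
      refine Metric.isCompact_of_isClosed_isBounded (hK.isClosed.preimage continuous_face) ?_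
      obtain ⟨R, hR⟩ := hK.isBounded.exists_norm_le
      refine isBounded_iff_forall_norm_le.2 ⟨R, fun y hy => ?_⟩
      have hn : ‖face y‖ = ‖y‖ := by
        simp [EuclideanSpace.norm_eq, Fin.sum_univ_succ, face]
      exact hn ▸ hR _ hy
    refine ((hc.mono fun y hy => hKt hy).integrableOn_compact hK').of_forall_sdiff_eq_zero hD
      fun y hy => ?_
    have h0 : chartPartition m M p (boundaryParam p y) = 0 :=
      image_eq_zero_of_notMem_tsupport (extChartAt_symm_notMem_tsupport ⟨hy.1, hy.2⟩)
    simp [h0]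
  rw [chartBoundaryMeasure]
  constructor
  · rw [integrable_map_measure hf.aestronglyMeasurable hparam,
      integrable_withDensity_iff_integrable_smul₀' hd (by simp)]
    refine hint.congr (.of_forall fun y => ?_)
    simp only [ENNReal.toReal_ofReal (boundaryDensity_nonneg φ p y), smul_eq_mul,
      Function.comp_apply]
  · rw [integral_map hparam hf.aestronglyMeasurable,
      integral_withDensity_eq_integral_toReal_smul₀ hd (by simp)]
    refine integral_congr_ae (.of_forall fun y => ?_)
    simp only [ENNReal.toReal_ofReal (boundaryDensity_nonneg φ p y), smul_eq_mul]

end Measure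

end FreeBoundary

end

theorem mainTheorem5 {m n : ℕ} {M : Type*} [TopologicalSpace M] [T2Space M] [CompactSpace M]
    [ChartedSpace (EuclideanHalfSpace (m + 1)) M] [IsManifold (𝓡∂ (m + 1)) ∞ M]
    [MeasurableSpace M] [BorelSpace M]
    (φ : M → EuclideanSpace ℝ (Fin n)) (hφ : FreeBoundary.IsFreeBoundaryMinimal m φ) :
    ∀ i : Fin n, MeasureTheory.Integrable (fun p => φ p i) (FreeBoundary.boundaryMeasure m φ) ∧
      ∫ p, φ p i ∂(FreeBoundary.boundaryMeasure m φ) = 0 := by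
  intro i
  obtain ⟨s, hs0, hs1⟩ := FreeBoundary.exists_finset_chartPartition m M
  have hcont : Continuous fun p => φ p i :=
    (EuclideanSpace.proj i : EuclideanSpace ℝ (Fin n) →L[ℝ] ℝ).continuous.comp
      hφ.contMDiff.continuous
  have hint := FreeBoundary.integrable_chartBoundaryMeasure hφ hcont
  rw [FreeBoundary.boundaryMeasure_eq_sum φ hs0]
  refine ⟨MeasureTheory.integrable_finsetSum_measure.2 fun p _ => (hint p).1, ?_⟩
  -- The right-hand zero is replaced by the vanishing sum of interior integrals with `e` the `i`-th
  -- basis vector; Green's formula then matches the two sides chart by chart.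
  rw [MeasureTheory.integral_finsetSum_measure fun p _ => (hint p).1,
    ← FreeBoundary.sum_setIntegral_chartDeriv_gradientFlux hφ (EuclideanSpace.single i 1)
      (fun p => (FreeBoundary.chartPartition m M p).contMDiff) hs1
      FreeBoundary.tsupport_chartPartition_subset]
  refine Finset.sum_congr rfl fun p _ => ?_
  rw [(hint p).2, FreeBoundary.setIntegral_chartDeriv_gradientFlux hφ _
    (FreeBoundary.chartPartition m M p).contMDiff (FreeBoundary.tsupport_chartPartition_subset p)]
  simp [EuclideanSpace.inner_single_right]
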